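/- Let $M$ be a connected smooth manifold of dimension $2n+1$ without boundary (compact or not), let $\alpha$ be a contact form on $M$, and let $\xi=\ker\alpha$. Let $\widetilde{\mathrm{Cont}}_0(M,\xi)$ be the universal cover of the identity component of the group of compactly supported contactomorphisms, i.e. the set of classes $[\phi_t]$ of smooth compactly supported contact isotopies $(\phi_t)_{t\in[0,1]}$ with $\phi_0=\mathrm{id}$, up to homotopy relative to the end points, with product $[\phi_t]\cdot[\psi_t]=[\phi_t\circ\psi_t]$. A Hamiltonian is a smooth, compactly supported, time-dependent function $H_t:M\to\mathbb R$, $t\in[0,1]$; it generates the contact isotopy $\phi^H_t$ with $\phi^H_0=\mathrm{id}$ and $\frac{\partial}{\partial t}\phi^H_t=X_t\circ\phi^H_t$, where $X_t$ is the contact vector field with $\alpha(X_t)=H_t$. For $f_0,f_1\in\widetilde{\mathrm{Cont}}_0(M,\xi)$ define, as infima in $[-\infty,\infty]$, $$\widetilde\delta^-_\alpha(f_0,f_1)=\inf\{\varepsilon\in\mathbb R \mid \exists\, H_t:M\to[-\varepsilon,\infty),\ [\phi^H_t]\cdot f_0=f_1\},$$ $$\widetilde\delta^+_\alpha(f_0,f_1)=\inf\{\varepsilon\in\mathbb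 R \mid \exists\, H_t:M\to(-\infty,\varepsilon],\ [\phi^H_t]\cdot f_0=f_1\},$$ $$\widetilde d_\alpha(f_0,f_1)=\max\{\widetilde\delta^-_\alpha(f_0,f_1),\widetilde\delta^+_\alpha(f_0,f_1),0\},$$ $$\widetilde\delta^\pm_{SH}(f_0,f_1)=\inf\Big\{\int_0^1\max_M(\pm H_t)\,dt \;\Big|\; [\phi^H_t]\cdot f_0=f_1\Big\},\qquad \widetilde d_{SH}(f_0,f_1)=\inf\Big\{\int_0^1\max_M|H_t|\,dt \;\Big|\; [\phi^H_t]\cdot f_0=f_1\Big\}.$$ Then for all $f_0,f_1\in\widetilde{\mathrm{Cont}}_0(M,\xi)$, $$\widetilde\delta^{+}_{SH}(f_0,f_1)=\widetilde\delta^{+}_\alpha(f_0,f_1),\qquad \widetilde\delta^{-}_{SH}(f_0,f_1)=\widetilde\delta^{-}_\alpha(f_0,f_1).$$ In particular, $$\widetilde d_\alpha(f_0,f_1)=\max\{\widetilde\delta^-_{SH}(f_0,f_1),\widetilde\delta^+_{SH}(f_0,f_1),0\}\le \widetilde d_{SH}(f_0,f_1).$$ -/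

import Mathlib

open scoped Manifold ContDiff
open Set Bundle

noncomputable section

namespace ContactGeometry

/-- The model space of a contact manifold of dimension `2n + 1`. -/
abbrev Model (n : ℕ) : Type := EuclideanSpace ℝ (Fin (2 * n + 1))

variable {n : ℕ} {M : Type*} [TopologicalSpace M] [ChartedSpace (Model n) M]

/-- The coordinate expression, in the chart around `x₀`, of a one-form `α` on `M`, i.e. the
pull-back of `α` under the inverse of the chart. -/
def chartForm (α : ∀ x : M, TangentSpace (𝓡 (2 * n + 1)) x →L[ℝ] ℝ) (x₀ : M)
    (z : Model n) : Model n →L[ℝ] ℝ :=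
  (α ((extChartAt (𝓡 (2 * n + 1)) x₀).symm z)).comp
    (mfderiv 𝓘(ℝ, Model n) (𝓡 (2 * n + 1)) (extChartAt (𝓡 (2 * n + 1)) x₀).symm z)

/-- The exterior derivative of a one-form `β` on an open subset of a vector space:
`dβ_z (u, v) = (D_u β)_z (v) - (D_v β)_z (u)`. -/
def dForm {E : Type*} [NormedAddCommGroup E] [NormedSpace ℝ E] (β : E → E →L[ℝ] ℝ) (z u v : E) :
    ℝ :=
  fderiv ℝ β z u v - fderiv ℝ β z v u

variable (n M) in
/-- A contact form on a manifold `M` of dimension `2n + 1`: a smooth, nowhere vanishing one-form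
`α` such that `dα` is non-degenerate on the hyperplane field `ξ = ker α`
(equivalently `α ∧ (dα)ⁿ` vanishes nowhere). The manifold is then endowed with the contact
structure `ξ = ker α`, cooriented by `α`. -/
structure ContactForm where
  /-- the value of the one-form at a point -/
  toFun : ∀ x : M, TangentSpace (𝓡 (2 * n + 1)) x →L[ℝ] ℝ
  smooth : ∀ x₀ : M, ContDiffOn ℝ ∞ (chartForm toFun x₀) (extChartAt (𝓡 (2 * n + 1)) x₀).target
  ne_zero : ∀ x : M, toFun x ≠ 0
  nondegenerate : ∀ x₀ : M, ∀ z ∈ (extChartAt (𝓡 (2 * n + 1)) x₀).target, ∀ u : Model n,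
    chartForm toFun x₀ z u = 0 →
    (∀ v : Model n, chartForm toFun x₀ z v = 0 → dForm (chartForm toFun x₀) z u v = 0) → u = 0

/-- `φ` preserves the contact structure `ξ = ker α`, i.e. a vector `v` is tangent to `ξ` if and
only if `dφ v` is. -/
def PreservesContact (α : ContactForm n M)
    (φ : M ≃ₘ⟮𝓡 (2 * n + 1), 𝓡 (2 * n + 1)⟯ M) : Prop :=
  ∀ (x : M) (v : TangentSpace (𝓡 (2 * n + 1)) x),
    α.toFun (φ x) (mfderiv (𝓡 (2 * n + 1)) (𝓡 (2 * n + 1)) φ x v) = 0 ↔ α.toFun x v = 0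

/-- A smooth compactly supported contact isotopy `(φ_t)`, `t ∈ [0, 1]`, of `(M, ker α)` starting at
the identity. Only the values at times `t ∈ [0, 1]` are relevant. -/
structure ContactIsotopy (α : ContactForm n M) where
  /-- the diffeomorphism at time `t` -/
  toFun : ℝ → M ≃ₘ⟮𝓡 (2 * n + 1), 𝓡 (2 * n + 1)⟯ M
  smooth : ContMDiffOn (𝓘(ℝ, ℝ).prod (𝓡 (2 * n + 1))) (𝓡 (2 * n + 1)) ∞
    (fun p : ℝ × M => toFun p.1 p.2) (Icc 0 1 ×ˢ univ)
  contact : ∀ t ∈ Icc (0 : ℝ) 1, PreservesContact α (toFun t)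
  zero : ∀ x : M, toFun 0 x = x
  compactSupport : ∃ K : Set M, IsCompact K ∧ ∀ t ∈ Icc (0 : ℝ) 1, ∀ x, x ∉ K → toFun t x = x

/-- `φ` and `ψ` have the same end point and are homotopic relative to the end points through
contact isotopies: there is a smooth family `Φ s`, `s ∈ [0, 1]`, of contact isotopies starting at
the identity, with fixed end point and supported in a common compact set, from `φ` to `ψ`. -/
def Homotopic {α : ContactForm n M} (φ ψ : ContactIsotopy α) : Prop :=
  ∃ Φ : ℝ → ContactIsotopy α,
    ContMDiffOn (𝓘(ℝ, ℝ).prod (𝓘(ℝ, ℝ).prod (𝓡 (2 * n + 1)))) (𝓡 (2 * n + 1)) ∞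
      (fun p : ℝ × ℝ × M => (Φ p.1).toFun p.2.1 p.2.2) (Icc 0 1 ×ˢ Icc 0 1 ×ˢ univ) ∧
    (∃ K : Set M, IsCompact K ∧ ∀ s ∈ Icc (0 : ℝ) 1, ∀ t ∈ Icc (0 : ℝ) 1, ∀ x, x ∉ K →
      (Φ s).toFun t x = x) ∧
    (∀ t ∈ Icc (0 : ℝ) 1, ∀ x, (Φ 0).toFun t x = φ.toFun t x) ∧
    (∀ t ∈ Icc (0 : ℝ) 1, ∀ x, (Φ 1).toFun t x = ψ.toFun t x) ∧
    (∀ s ∈ Icc (0 : ℝ) 1, ∀ x, (Φ s).toFun 1 x = φ.toFun 1 x)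

/-- The universal cover of the identity component `Cont₀(M, ξ)` of the group of compactly supported
contactomorphisms of `(M, ξ = ker α)`: contact isotopies starting at the identity, up to
homotopy relative to the end points. -/
def UniversalCover (α : ContactForm n M) : Type _ :=
  Quot (Homotopic (α := α))

/-- The class `[φ_t]` of a contact isotopy in the universal cover. -/
def ContactIsotopy.toCover {α : ContactForm n M} (φ : ContactIsotopy α) : UniversalCover α :=
  Quot.mk _ φ

/-- The composition of two diffeomorphisms preserving the contact structure preserves it. -/
theorem PreservesContact.comp {α : ContactForm n M}
    {φ ψ : M ≃ₘ⟮𝓡 (2 * n + 1), 𝓡 (2 * n + 1)⟯ M}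
    (hφ : PreservesContact α φ) (hψ : PreservesContact α ψ) :
    PreservesContact α (ψ.trans φ) := by
  intro x v
  have h : mfderiv (𝓡 (2 * n + 1)) (𝓡 (2 * n + 1)) (ψ.trans φ) x =
      (mfderiv (𝓡 (2 * n + 1)) (𝓡 (2 * n + 1)) φ (ψ x)).comp
        (mfderiv (𝓡 (2 * n + 1)) (𝓡 (2 * n + 1)) ψ x) := by
    rw [Diffeomorph.coe_trans]
    exact mfderiv_comp x (φ.mdifferentiable (by simp) (ψ x)) (ψ.mdifferentiable (by simp) x)
  rw [h]
  exact (hφ (ψ x) _).trans (hψ x v)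

/-- The product of contact isotopies, `(φ ψ)_t = φ_t ∘ ψ_t`. -/
def ContactIsotopy.mul {α : ContactForm n M} (φ ψ : ContactIsotopy α) : ContactIsotopy α where
  toFun t := (ψ.toFun t).trans (φ.toFun t)
  smooth := by
    have h : ContMDiffOn (𝓘(ℝ, ℝ).prod (𝓡 (2 * n + 1))) (𝓘(ℝ, ℝ).prod (𝓡 (2 * n + 1))) ∞
        (fun p : ℝ × M => (p.1, ψ.toFun p.1 p.2)) (Icc 0 1 ×ˢ univ) :=
      contMDiffOn_fst.prodMk ψ.smooth
    exact φ.smooth.comp h fun p hp => ⟨hp.1, mem_univ _⟩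
  contact t ht := (φ.contact t ht).comp (ψ.contact t ht)
  zero x := by simp [φ.zero, ψ.zero]
  compactSupport := by
    obtain ⟨K, hK, hφ⟩ := φ.compactSupport
    obtain ⟨L, hL, hψ⟩ := ψ.compactSupport
    refine ⟨K ∪ L, hK.union hL, fun t ht x hx => ?_⟩
    simp only [mem_union, not_or] at hx
    simp [hψ t ht x hx.2, hφ t ht x hx.1]

/-- A contact isotopy is homotopic to itself. -/
theorem Homotopic.refl {α : ContactForm n M} (φ : ContactIsotopy α) : Homotopic φ φ := by
  refine ⟨fun _ => φ, ?_, ?_, fun _ _ _ => rfl, fun _ _ _ => rfl, fun _ _ _ => rfl⟩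
  · exact φ.smooth.comp (contMDiffOn_snd (s := Icc (0 : ℝ) 1 ×ˢ Icc (0 : ℝ) 1 ×ˢ (univ : Set M)))
      fun p hp => hp.2
  · obtain ⟨K, hK, h⟩ := φ.compactSupport
    exact ⟨K, hK, fun _ _ => h⟩

/-- Products of homotopic contact isotopies are homotopic. -/
theorem Homotopic.mul {α : ContactForm n M} {φ φ' ψ ψ' : ContactIsotopy α}
    (hφ : Homotopic φ φ') (hψ : Homotopic ψ ψ') : Homotopic (φ.mul ψ) (φ'.mul ψ') := by
  obtain ⟨Φ, hΦ, ⟨K, hK, hΦK⟩, hΦ0, hΦ1, hΦe⟩ := hφ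
  obtain ⟨Ψ, hΨ, ⟨L, hL, hΨL⟩, hΨ0, hΨ1, hΨe⟩ := hψ
  refine ⟨fun s => (Φ s).mul (Ψ s), ?_, ⟨K ∪ L, hK.union hL, ?_⟩, ?_, ?_, ?_⟩
  · have h : ContMDiffOn (𝓘(ℝ, ℝ).prod (𝓘(ℝ, ℝ).prod (𝓡 (2 * n + 1))))
        (𝓘(ℝ, ℝ).prod (𝓘(ℝ, ℝ).prod (𝓡 (2 * n + 1)))) ∞
        (fun p : ℝ × ℝ × M => (p.1, p.2.1, (Ψ p.1).toFun p.2.1 p.2.2))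
        (Icc 0 1 ×ˢ Icc 0 1 ×ˢ univ) :=
      contMDiffOn_fst.prodMk ((contMDiff_fst.comp contMDiff_snd).contMDiffOn.prodMk hΨ)
    exact hΦ.comp h fun p hp => ⟨hp.1, hp.2.1, mem_univ _⟩
  · intro s hs t ht x hx
    simp only [mem_union, not_or] at hx
    simp [ContactIsotopy.mul, hΨL s hs t ht x hx.2, hΦK s hs t ht x hx.1]
  · intro t ht x
    simp [ContactIsotopy.mul, hΨ0 t ht, hΦ0 t ht]
  · intro t ht x
    simp [ContactIsotopy.mul, hΨ1 t ht, hΦ1 t ht]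
  · intro s hs x
    simp [ContactIsotopy.mul, hΨe s hs, hΦe s hs]

/-- The product `[φ_t] · [ψ_t] = [φ_t ∘ ψ_t]` on the universal cover. -/
instance (α : ContactForm n M) : Mul (UniversalCover α) where
  mul := Quot.map₂ ContactIsotopy.mul (fun φ _ _ h => (Homotopic.refl φ).mul h)
    (fun _ _ ψ h => h.mul (Homotopic.refl ψ))

variable (n) in
/-- A (time-dependent, compactly supported, smooth) Hamiltonian `H_t : M → ℝ`, `t ∈ [0, 1]`.
Only the values at times `t ∈ [0, 1]` are relevant. -/
structure IsHamiltonian (H : ℝ → M → ℝ) : Prop where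
  smooth : ContMDiffOn (𝓘(ℝ, ℝ).prod (𝓡 (2 * n + 1))) 𝓘(ℝ, ℝ) ∞
    (fun p : ℝ × M => H p.1 p.2) (Icc 0 1 ×ˢ univ)
  compactSupport : ∃ K : Set M, IsCompact K ∧ ∀ t ∈ Icc (0 : ℝ) 1, ∀ x, x ∉ K → H t x = 0

/-- The velocity `∂/∂t φ_t(x)` of a contact isotopy at time `t ∈ [0, 1]`
(one-sided at `t = 0` and `t = 1`). -/
def ContactIsotopy.velocity {α : ContactForm n M} (φ : ContactIsotopy α) (t : ℝ) (x : M) :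
    TangentSpace (𝓡 (2 * n + 1)) (φ.toFun t x) :=
  mfderivWithin 𝓘(ℝ, ℝ) (𝓡 (2 * n + 1)) (fun s => φ.toFun s x) (Icc 0 1) t (1 : ℝ)

/-- The Hamiltonian `H` generates the contact isotopy `φ`, i.e. `φ = φ^H`: the contact vector field
`X_t` with `∂/∂t φ_t = X_t ∘ φ_t` satisfies `α(X_t) = H_t`. (A contact vector field `X` is uniquely
determined by its Hamiltonian `α(X)`, and `X_t` is a contact vector field as `φ` is a contact
isotopy.) -/
structure Generates {α : ContactForm n M} (H : ℝ → M → ℝ) (φ : ContactIsotopy α) : Prop where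
  isHamiltonian : IsHamiltonian n H
  velocity_eq : ∀ t ∈ Icc (0 : ℝ) 1, ∀ x : M,
    α.toFun (φ.toFun t x) (φ.velocity t x) = H t (φ.toFun t x)

/-- `H` is a Hamiltonian with `[φ^H_t] · f₀ = f₁` in the universal cover. -/
def Connects {α : ContactForm n M} (H : ℝ → M → ℝ) (f₀ f₁ : UniversalCover α) : Prop :=
  ∃ φ : ContactIsotopy α, Generates H φ ∧ φ.toCover * f₀ = f₁

variable {α : ContactForm n M}

/-- `δ̃⁻_α(f₀, f₁)`: the infimum (in the extended reals) of all real `ε` for which there is a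
Hamiltonian `H_t : M → [-ε, ∞)` with `[φ^H_t] · f₀ = f₁`. -/
def deltaMinus (f₀ f₁ : UniversalCover α) : EReal :=
  sInf {e : EReal | ∃ ε : ℝ, e = ε ∧
    ∃ H : ℝ → M → ℝ, Connects H f₀ f₁ ∧ ∀ t ∈ Icc (0 : ℝ) 1, ∀ x, -ε ≤ H t x}

/-- `δ̃⁺_α(f₀, f₁)`: the infimum (in the extended reals) of all real `ε` for which there is a
Hamiltonian `H_t : M → (-∞, ε]` with `[φ^H_t] · f₀ = f₁`. -/
def deltaPlus (f₀ f₁ : UniversalCover α) : EReal :=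
  sInf {e : EReal | ∃ ε : ℝ, e = ε ∧
    ∃ H : ℝ → M → ℝ, Connects H f₀ f₁ ∧ ∀ t ∈ Icc (0 : ℝ) 1, ∀ x, H t x ≤ ε}

/-- `d̃_α = max {δ̃⁻_α, δ̃⁺_α, 0}`. -/
def dTilde (f₀ f₁ : UniversalCover α) : EReal :=
  max (max (deltaMinus f₀ f₁) (deltaPlus f₀ f₁)) 0

/-- `‖H_t‖⁺ = ∫₀¹ max_M H_t dt` -/
def energyPlus (H : ℝ → M → ℝ) : ℝ := ∫ t in (0 : ℝ)..1, ⨆ x, H t x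

/-- `‖H_t‖⁻ = ∫₀¹ max_M (-H_t) dt` -/
def energyMinus (H : ℝ → M → ℝ) : ℝ := ∫ t in (0 : ℝ)..1, ⨆ x, -H t x

/-- `‖H_t‖ = ∫₀¹ max_M |H_t| dt` -/
def energy (H : ℝ → M → ℝ) : ℝ := ∫ t in (0 : ℝ)..1, ⨆ x, |H t x|

/-- `δ̃⁺_SH(f₀, f₁)`: the infimum (in the extended reals) of `‖H_t‖⁺` over all Hamiltonians with
`[φ^H_t] · f₀ = f₁`. -/
def deltaPlusSH (f₀ f₁ : UniversalCover α) : EReal :=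
  sInf {e : EReal | ∃ H : ℝ → M → ℝ, Connects H f₀ f₁ ∧ e = energyPlus H}

/-- `δ̃⁻_SH(f₀, f₁)`: the infimum (in the extended reals) of `‖H_t‖⁻` over all Hamiltonians with
`[φ^H_t] · f₀ = f₁`. -/
def deltaMinusSH (f₀ f₁ : UniversalCover α) : EReal :=
  sInf {e : EReal | ∃ H : ℝ → M → ℝ, Connects H f₀ f₁ ∧ e = energyMinus H}

/-- The Shelukhin–Hofer pseudo-metric `d̃_SH` on the universal cover: the infimum of `‖H_t‖` over
all Hamiltonians with `[φ^H_t] · f₀ = f₁`. -/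
def dSH (f₀ f₁ : UniversalCover α) : EReal :=
  sInf {e : EReal | ∃ H : ℝ → M → ℝ, Connects H f₀ f₁ ∧ e = energy H}

end ContactGeometry

end

/-! A uniform bound on `± H` bounds the integral of its maximum, since the time interval has length
one. For the converse, let s = ± 1 and let c be any real number larger than the integral of max (s
H_t). It suffices to find, in the same class of the universal cover, an isotopy whose Hamiltonian K
satisfies s K ≤ c everywhere. Choose a smooth p(t) ≥ max (s H_t) with integral exactly c
(`exists_smooth_majorant`). Two different devices are then needed.

If M is not compact, H_t vanishes somewhere, so max (s H_t) ≥ 0 and p can be taken bounded below by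
a positive constant. The time change τ with τ' = c / p(τ) fixes 0 and 1, and the reparametrised
Hamiltonian τ' H_τ satisfies s τ' H_τ ≤ c (`exists_time_change`, `Generates.reparam`). The isotopy
is deformed by interpolating between τ and the identity.

If M is compact, max (s H_t) may be negative, but the Reeb vector field has a complete flow R
preserving α. Replacing φ_t by R_{a(t)} ∘ φ_t changes the Hamiltonian to a' + H_t ∘ R_{-a}
(`Generates.twist`). With a(t) = s (c t - ∫₀ᵗ p), s times this is c - p + s H_t ∘ R_{-a} ≤ c. As a
vanishes at both ends, scaling it to 0 gives the homotopy.

Much of the work lies in the Reeb flow itself: the smooth flow of a vector field on a closed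
manifold (`exists_flow_of_compactSpace`), the smoothness of the Reeb field
(`ContactForm.contMDiff_reebField`) and the invariance of α (`ContactForm.pullback_reeb_flow`). The
inequality with the Shelukhin–Hofer distance only uses ± r ≤ |r|. -/

noncomputable section

/-! ### Smoothness of post-composition on spaces of continuous functions -/

section Composition

universe u

variable {K E F W : Type*} [TopologicalSpace K] [CompactSpace K]
  [NormedAddCommGroup E] [NormedSpace ℝ E] [NormedAddCommGroup F] [NormedSpace ℝ F]
  [NormedAddCommGroup W] [NormedSpace ℝ W]

/-- Pointwise evaluation of a continuous bilinear map on continuous functions. -/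
def ContinuousMap.pointwiseBilin (B : W →L[ℝ] E →L[ℝ] F) :
    C(K, W) →L[ℝ] C(K, E) →L[ℝ] C(K, F) :=
  LinearMap.mkContinuous₂
    (LinearMap.mk₂ ℝ (fun (A : C(K, W)) (h : C(K, E)) =>
        (⟨fun k => B (A k) (h k), by fun_prop⟩ : C(K, F)))
      (fun A B h => by ext; simp) (fun c A h => by ext; simp)
      (fun A h h' => by ext; simp) (fun c A h => by ext; simp)) ‖B‖
    (fun A h => by
      rw [ContinuousMap.norm_le _ (by positivity)]
      intro k
      refine (B.le_opNorm₂ (A k) (h k)).trans ?_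
      gcongr
      · exact A.norm_coe_le_norm k
      · exact h.norm_coe_le_norm k)

/-- Composition with a fixed map whose derivative is Lipschitz is differentiable on `C(K, E)`. -/
theorem ContinuousMap.hasFDerivAt_comp_left {f : E → F} (hf : Continuous f) {f' : E → W}
    (hf' : Continuous f') (B : W →L[ℝ] E →L[ℝ] F) (hd : ∀ x, HasFDerivAt f (B (f' x)) x)
    {L : NNReal} (hL : LipschitzWith L fun x => B (f' x)) (γ : C(K, E)) :
    HasFDerivAt (fun γ : C(K, E) => (⟨f, hf⟩ : C(E, F)).comp γ)
      (ContinuousMap.pointwiseBilin B ((⟨f', hf'⟩ : C(E, W)).comp γ)) γ := by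
  rw [hasFDerivAt_iff_isLittleO_nhds_zero]
  have hO : (fun h : C(K, E) => (⟨f, hf⟩ : C(E, F)).comp (γ + h) - (⟨f, hf⟩ : C(E, F)).comp γ -
      ContinuousMap.pointwiseBilin B ((⟨f', hf'⟩ : C(E, W)).comp γ) h)
      =O[nhds 0] fun h : C(K, E) => ‖h‖ ^ 2 := by
    refine Asymptotics.IsBigO.of_bound L (Filter.Eventually.of_forall fun h => ?_)
    rw [ContinuousMap.norm_le _ (by positivity)]
    intro k
    have hk := h.norm_coe_le_norm k
    -- Mean value inequality: on the ball of radius `‖h‖` the derivative of `f` varies by at most `L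
    -- * ‖h‖`, so the remainder is at most `L * ‖h‖ ^ 2`, uniformly in `k`.
    have := (convex_closedBall (γ k) ‖h‖).norm_image_sub_le_of_norm_hasFDerivWithin_le'
      (f := f) (f' := fun x => B (f' x)) (φ := B (f' (γ k))) (C := L * ‖h‖) (x := γ k)
      (y := γ k + h k) (fun x _ => (hd x).hasFDerivWithinAt)
      (fun x hx => by
        rw [← dist_eq_norm]
        refine (hL.dist_le_mul _ _).trans ?_
        gcongr
        exact hx)
      (Metric.mem_closedBall_self (norm_nonneg _)) (by simpa [dist_eq_norm] using hk)
    simp only [add_sub_cancel_left] at this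
    rw [Real.norm_of_nonneg (by positivity)]
    have h2 : (L : ℝ) * ‖h‖ * ‖h k‖ ≤ L * ‖h‖ ^ 2 := by
      rw [sq, ← mul_assoc]
      gcongr
    exact this.trans h2
  exact hO.trans_isLittleO (by
    simpa using (Asymptotics.isLittleO_norm_pow_id (E' := C(K, E)) one_lt_two))

/-- The derivative of post-composition with `f` is post-composition with `f'` followed by a fixed
continuous linear map, so it inherits the regularity of the latter and one order is gained. -/
theorem ContinuousMap.contDiff_succ_comp_left {f : E → F} (hf : Continuous f) {f' : E → W}
    (hf' : Continuous f') (B : W →L[ℝ] E →L[ℝ] F) (hd : ∀ x, HasFDerivAt f (B (f' x)) x)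
    {L : NNReal} (hL : LipschitzWith L fun x => B (f' x)) {m : ℕ}
    (h : ContDiff ℝ m (fun γ : C(K, E) => (⟨f', hf'⟩ : C(E, W)).comp γ)) :
    ContDiff ℝ (m + 1) (fun γ : C(K, E) => (⟨f, hf⟩ : C(E, F)).comp γ) :=
  contDiff_succ_iff_hasFDerivAt.2 ⟨_, (ContinuousMap.pointwiseBilin B).contDiff.comp h,
    ContinuousMap.hasFDerivAt_comp_left hf hf' B hd hL⟩

/-- Composition with a fixed compactly supported smooth map is smooth on `C(K, E)`. -/
theorem ContinuousMap.contDiff_comp_left {E : Type u} [NormedAddCommGroup E] [NormedSpace ℝ E]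
    (m : ℕ) :
    ∀ {F : Type u} [NormedAddCommGroup F] [NormedSpace ℝ F] {f : E → F} (hf : ContDiff ℝ ∞ f)
      (_ : HasCompactSupport f),
      ContDiff ℝ m (fun γ : C(K, E) => (⟨f, hf.continuous⟩ : C(E, F)).comp γ) := by
  induction m with
  | zero =>
    intro F _ _ f hf _
    exact contDiff_zero.2 (ContinuousMap.continuous_postcomp _)
  -- The target space varies in the induction: the step passes from `F` to `E →L[ℝ] F`, which is why
  -- both spaces lie in one universe.
  | succ m ih =>
    intro F _ _ f hf hc
    have hf' : ContDiff ℝ ∞ (fderiv ℝ f) := hf.fderiv_right (by simp)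
    obtain ⟨L, hL⟩ := hf'.lipschitzWith_of_hasCompactSupport (hc.fderiv ℝ) (by simp)
    exact ContinuousMap.contDiff_succ_comp_left hf.continuous hf'.continuous
      (.id ℝ (E →L[ℝ] F)) (fun x => (hf.differentiable (by simp) x).hasFDerivAt) hL
      (ih hf' (hc.fderiv ℝ))

end Composition

/-! ### Local flows by the implicit function theorem -/

section LocalFlow

variable {E : Type*} [NormedAddCommGroup E] [NormedSpace ℝ E]

/-- The primitive, vanishing at `0`, of a continuous function on `[0, 1]`. -/
def unitPrimitive [CompleteSpace E] : C(Icc (0 : ℝ) 1, E) →L[ℝ] C(Icc (0 : ℝ) 1, E) :=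
  LinearMap.mkContinuous
    { toFun := fun g => ⟨fun s => ∫ r in (0 : ℝ)..s, g (projIcc 0 1 zero_le_one r),
        (intervalIntegral.continuous_primitive (fun a b =>
          (g.continuous.comp continuous_projIcc).intervalIntegrable a b) 0).comp
            continuous_subtype_val⟩
      map_add' := fun g h => by
        ext s
        exact intervalIntegral.integral_add
          ((g.continuous.comp continuous_projIcc).intervalIntegrable _ _)
          ((h.continuous.comp continuous_projIcc).intervalIntegrable _ _)
      map_smul' := fun c g => by
        ext s
        exact intervalIntegral.integral_smul c _ } 1
    (fun g => by
      rw [one_mul, ContinuousMap.norm_le _ (norm_nonneg _)]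
      intro s
      have := intervalIntegral.norm_integral_le_of_norm_le_const (a := (0 : ℝ)) (b := s)
        (f := fun r => g (projIcc 0 1 zero_le_one r)) (C := ‖g‖)
        (fun r _ => g.norm_coe_le_norm _)
      refine this.trans ?_
      rw [sub_zero, abs_of_nonneg s.2.1]
      exact mul_le_of_le_one_right (norm_nonneg _) s.2.2)

theorem unitPrimitive_apply [CompleteSpace E] (g : C(Icc (0 : ℝ) 1, E)) (s : Icc (0 : ℝ) 1) :
    unitPrimitive g s = ∫ r in (0 : ℝ)..s, g (projIcc 0 1 zero_le_one r) := rfl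

/-- Constant functions, as a continuous linear map. -/
def unitConst : E →L[ℝ] C(Icc (0 : ℝ) 1, E) :=
  LinearMap.mkContinuous
    { toFun := fun x => ContinuousMap.const _ x
      map_add' := fun _ _ => rfl
      map_smul' := fun _ _ => rfl } 1
    (fun x => by
      rw [one_mul, ContinuousMap.norm_le _ (norm_nonneg _)]
      intro s
      exact le_rfl)

theorem unitConst_apply (x : E) (s : Icc (0 : ℝ) 1) : unitConst x s = x := rfl

/-- A compactly supported smooth vector field has a local flow that is smooth at time zero. -/
theorem exists_local_flow [CompleteSpace E] {f : E → E} (hf : ContDiff ℝ ∞ f)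
    (hc : HasCompactSupport f) (x₀ : E) :
    ∃ ρ : ℝ × E → E, ContDiffAt ℝ ∞ ρ (0, x₀) ∧ ∃ r > (0 : ℝ),
      ∀ x ∈ Metric.ball x₀ r, ρ (0, x) = x ∧ ∀ t ∈ Ioo (-r) r,
        HasDerivAt (fun s => ρ (s, x)) (f (ρ (t, x))) t := by
  set Cf : C(Icc (0 : ℝ) 1, E) → C(Icc (0 : ℝ) 1, E) :=
    fun γ => (⟨f, hf.continuous⟩ : C(E, E)).comp γ with hCf
  have hCfs : ContDiff ℝ ∞ Cf := contDiff_infty.2 fun m =>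
    ContinuousMap.contDiff_comp_left m hf hc
  -- Picard's equation rescaled to the unit interval: the zeros are the curves γ(s) = x + t ∫₀ˢ
  -- f(γ), that is γ(s) = flow of `x` at time `t * s`. Time has become a parameter, and at `t = 0`
  -- the equation reads γ = x, so its derivative in γ is the identity.
  set Φ : (ℝ × E) × C(Icc (0 : ℝ) 1, E) → C(Icc (0 : ℝ) 1, E) :=
    fun p => p.2 - unitConst p.1.2 - p.1.1 • unitPrimitive (Cf p.2) with hΦ
  have hΦs : ContDiff ℝ ∞ Φ :=
    (contDiff_snd.sub (unitConst.contDiff.comp (contDiff_snd.comp contDiff_fst))).sub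
      ((contDiff_fst.comp contDiff_fst).smul
        (unitPrimitive.contDiff.comp (hCfs.comp contDiff_snd)))
  set u : (ℝ × E) × C(Icc (0 : ℝ) 1, E) := ((0, x₀), unitConst x₀) with hu
  have hΦu : Φ u = 0 := by simp [hΦ, hu]
  have hinr : fderiv ℝ Φ u ∘L .inr ℝ (ℝ × E) C(Icc (0 : ℝ) 1, E) = .id ℝ _ := by
    have h1 : HasFDerivAt (fun γ => Φ ((0, x₀), γ))
        (fderiv ℝ Φ u ∘L .inr ℝ (ℝ × E) C(Icc (0 : ℝ) 1, E)) (unitConst x₀) :=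
      ((hΦs.differentiable (by simp) u).hasFDerivAt).comp (unitConst x₀)
        (hasFDerivAt_prodMk_right (0, x₀) (unitConst x₀))
    have h2 : HasFDerivAt (fun γ => Φ ((0, x₀), γ))
        (.id ℝ C(Icc (0 : ℝ) 1, E)) (unitConst x₀) := by
      have : (fun γ => Φ ((0, x₀), γ)) = fun γ => γ - unitConst x₀ := by
        ext γ; simp [hΦ]
      rw [this]
      exact (hasFDerivAt_id _).sub_const _
    exact h1.unique h2
  have hinv : (fderiv ℝ Φ u ∘L .inr ℝ (ℝ × E) C(Icc (0 : ℝ) 1, E)).IsInvertible := by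
    rw [hinr]; exact ⟨.refl ℝ _, rfl⟩
  have hn : (∞ : WithTop ℕ∞) ≠ 0 := by simp
  set G := hΦs.contDiffAt.implicitFunction hn hinv with hG
  have hGs : ContDiffAt ℝ ∞ G (0, x₀) := hΦs.contDiffAt.contDiffAt_implicitFunction hn hinv
  have hGe : ∀ᶠ p in nhds ((0 : ℝ), x₀), Φ (p, G p) = 0 := by
    have := hΦs.contDiffAt.eventually_apply_implicitFunction hn hinv
    rwa [hΦu] at this
  obtain ⟨r₁, hr₁, ε, hε, hcur⟩ :=
    (hf.contDiffAt (x := x₀)).of_le (m := 1) (by simp)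
      |>.exists_forall_mem_closedBall_exists_eq_forall_mem_Ioo_hasDerivAt 0
  obtain ⟨r₂, hr₂, hGr⟩ := Metric.eventually_nhds_iff_ball.1 hGe
  obtain ⟨L, hL⟩ := hf.lipschitzWith_of_hasCompactSupport hc (by simp)
  let one : Icc (0 : ℝ) 1 := ⟨1, right_mem_Icc.2 zero_le_one⟩
  -- The implicit function solves the equation in `s` for each fixed `t`. Its end point is
  -- identified with a genuine integral curve `c` at time `t` by uniqueness for the field `t • f`;
  -- the differential equation in `t` is then read off from `c`.
  have key : ∀ t x, (t, x) ∈ Metric.ball ((0 : ℝ), x₀) r₂ → |t| < ε → ∀ c : ℝ → E, c 0 = x →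
      (∀ s ∈ Ioo (0 - ε) (0 + ε), HasDerivAt c (f (c s)) s) → G (t, x) one = c t := by
    intro t x htx ht c hc0 hcd
    set γ := G (t, x) with hγ
    have hγe : ∀ s : Icc (0 : ℝ) 1,
        γ s = x + t • ∫ q in (0 : ℝ)..s, f (γ (projIcc 0 1 zero_le_one q)) := by
      intro s
      have := congrArg (fun g => g s) (hGr _ htx)
      simp only [hΦ, ContinuousMap.sub_apply, unitConst_apply, ContinuousMap.smul_apply,
        unitPrimitive_apply, ContinuousMap.zero_apply] at this
      rw [sub_sub, sub_eq_zero] at this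
      exact this
    set y : ℝ → E := fun s => x + t • ∫ q in (0 : ℝ)..s, f (γ (projIcc 0 1 zero_le_one q)) with hy
    have hyd : ∀ s, HasDerivAt y (t • f (γ (projIcc 0 1 zero_le_one s))) s := fun s =>
      ((((hf.continuous.comp (γ.continuous.comp continuous_projIcc)).integral_hasStrictDerivAt
        0 s).hasDerivAt).const_smul t).const_add x
    have hcd' : ∀ s ∈ Icc (0 : ℝ) 1, HasDerivAt (fun s => c (t * s)) (t • f (c (t * s))) s := by
      intro s hs
      have hmem : t * s ∈ Ioo (0 - ε) (0 + ε) := by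
        have : |t * s| < ε := by
          rw [abs_mul, abs_of_nonneg hs.1]
          exact (mul_le_of_le_one_right (abs_nonneg _) hs.2).trans_lt ht
        simpa using abs_lt.1 this
      have := (hcd _ hmem).scomp s ((hasDerivAt_id s).const_mul t)
      simpa [Function.comp_def] using this
    have huniq := ODE_solution_unique (v := fun _ z => t • f z) (K := ‖t‖₊ * L) (a := 0) (b := 1)
      (f := y) (g := fun s => c (t * s))
      (fun _ => (lipschitzWith_smul t).comp hL)
      (fun s _ => (hyd s).continuousAt.continuousWithinAt)
      (fun s hs => by
        have h1 := hγe ⟨s, Ico_subset_Icc_self hs⟩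
        have h2 := (hyd s).hasDerivWithinAt (s := Ici s)
        rw [projIcc_of_mem zero_le_one (Ico_subset_Icc_self hs), h1] at h2
        exact h2)
      (fun s hs => (hcd' s hs).continuousAt.continuousWithinAt)
      (fun s hs => (hcd' s (Ico_subset_Icc_self hs)).hasDerivWithinAt)
      (by simp [hy, hc0])
    have h1 := huniq (right_mem_Icc.2 zero_le_one)
    simp only [mul_one] at h1
    rw [← h1]
    exact hγe one
  refine ⟨fun p => G p one, ?_, min (min r₁ ε) r₂, by positivity, fun x hx => ?_⟩
  · exact (ContinuousMap.evalCLM ℝ one).contDiff.contDiffAt.comp _ hGs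
  · simp only [Metric.mem_ball, lt_min_iff] at hx
    obtain ⟨c, hc0, hcd⟩ := hcur x (Metric.mem_closedBall.2 hx.1.1.le)
    have hρ : ∀ t ∈ Ioo (-min (min r₁ ε) r₂) (min (min r₁ ε) r₂), G (t, x) one = c t := by
      intro t ht
      have ht' := abs_lt.2 ht
      simp only [lt_min_iff] at ht'
      refine key t x ?_ ht'.1.2 c hc0 hcd
      simp only [Metric.mem_ball, Prod.dist_eq, max_lt_iff]
      exact ⟨by simpa using ht'.2, hx.2⟩
    have hpos : 0 < min (min r₁ ε) r₂ := by positivity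
    refine ⟨(hρ 0 ⟨by linarith, hpos⟩).trans hc0, fun t ht => ?_⟩
    show HasDerivAt (fun s => G (s, x) one) (f (G (t, x) one)) t
    have ht' := abs_lt.2 ht
    simp only [lt_min_iff] at ht'
    have h := hcd t (by simpa using abs_lt.1 ht'.1.2)
    rw [hρ t ht]
    refine h.congr_of_eventuallyEq ?_
    filter_upwards [isOpen_Ioo.mem_nhds ht] with s hs using hρ s hs

end LocalFlow

end

noncomputable section

/-! ### Flows of vector fields on manifolds -/

section ManifoldFlow

variable {E : Type*} [NormedAddCommGroup E] [NormedSpace ℝ E]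
  {M : Type*} [TopologicalSpace M] [ChartedSpace E M] [IsManifold 𝓘(ℝ, E) ∞ M]

theorem isInvertible_mfderiv_extChartAt_symm {x₀ : M} {z : E}
    (hz : z ∈ (extChartAt 𝓘(ℝ, E) x₀).target) :
    (mfderiv 𝓘(ℝ, E) 𝓘(ℝ, E) (extChartAt 𝓘(ℝ, E) x₀).symm z).IsInvertible := by
  have := isInvertible_mfderivWithin_extChartAt_symm hz
  rwa [ModelWithCorners.range_eq_univ, mfderivWithin_univ] at this

theorem mdifferentiableAt_extChartAt_symm {x₀ : M} {z : E}
    (hz : z ∈ (extChartAt 𝓘(ℝ, E) x₀).target) :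
    MDifferentiableAt 𝓘(ℝ, E) 𝓘(ℝ, E) (extChartAt 𝓘(ℝ, E) x₀).symm z :=
  ((contMDiffOn_extChartAt_symm (n := ∞) x₀).contMDiffAt
    ((isOpen_extChartAt_target x₀).mem_nhds hz)).mdifferentiableAt (by simp)

/-- The coordinate expression of a vector field in the chart around `x₀`. -/
def chartField (X : ∀ x : M, TangentSpace 𝓘(ℝ, E) x) (x₀ : M) (z : E) : E :=
  (mfderiv 𝓘(ℝ, E) 𝓘(ℝ, E) (extChartAt 𝓘(ℝ, E) x₀).symm z).inverse
    (X ((extChartAt 𝓘(ℝ, E) x₀).symm z))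

theorem mfderiv_chartField (X : ∀ x : M, TangentSpace 𝓘(ℝ, E) x) {x₀ : M} {z : E}
    (hz : z ∈ (extChartAt 𝓘(ℝ, E) x₀).target) :
    mfderiv 𝓘(ℝ, E) 𝓘(ℝ, E) (extChartAt 𝓘(ℝ, E) x₀).symm z (chartField (E := E) X x₀ z) =
      X ((extChartAt 𝓘(ℝ, E) x₀).symm z) := by
  exact (isInvertible_mfderiv_extChartAt_symm hz).self_apply_inverse _

theorem contDiffOn_chartField [CompleteSpace E] {X : ∀ x : M, TangentSpace 𝓘(ℝ, E) x}
    (hX : ContMDiff 𝓘(ℝ, E) 𝓘(ℝ, E).tangent ∞ (fun x => (⟨x, X x⟩ : TangentBundle 𝓘(ℝ, E) M)))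
    (x₀ : M) : ContDiffOn ℝ ∞ (chartField X x₀) (extChartAt 𝓘(ℝ, E) x₀).target := by
  intro z hz
  refine contMDiffWithinAt_vectorSpace_iff_contDiffWithinAt.1 ?_
  have h := ContMDiffAt.mpullback_vectorField_preimage (V := X) (m := ∞) (n := ∞) (x₀ := z)
    (f := (extChartAt 𝓘(ℝ, E) x₀).symm) (hX _)
    ((contMDiffOn_extChartAt_symm (n := ∞) x₀).contMDiffAt
      ((isOpen_extChartAt_target x₀).mem_nhds hz))
    (isInvertible_mfderiv_extChartAt_symm hz) (by simp)
  exact h.contMDiffWithinAt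

/-- A smooth vector field has, near any point, a local flow that is smooth at time zero. -/
theorem exists_local_mflow [FiniteDimensional ℝ E] {X : ∀ x : M, TangentSpace 𝓘(ℝ, E) x}
    (hX : ContMDiff 𝓘(ℝ, E) 𝓘(ℝ, E).tangent ∞ (fun x => (⟨x, X x⟩ : TangentBundle 𝓘(ℝ, E) M)))
    (x₀ : M) :
    ∃ r : ℝ × M → M, ContMDiffAt (𝓘(ℝ, ℝ).prod 𝓘(ℝ, E)) 𝓘(ℝ, E) ∞ r (0, x₀) ∧
      ∃ ε > (0 : ℝ), ∃ U ∈ nhds x₀, ∀ x ∈ U, r (0, x) = x ∧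
        IsMIntegralCurveOn (fun t => r (t, x)) X (Ioo (-ε) ε) := by
  have : CompleteSpace E := FiniteDimensional.complete ℝ E
  set e := extChartAt 𝓘(ℝ, E) x₀ with he
  set z₀ := e x₀ with hz₀
  have hz₀t : z₀ ∈ e.target := mem_extChartAt_target x₀
  have hto : IsOpen e.target := isOpen_extChartAt_target x₀
  have hf₀ : ContDiffOn ℝ ∞ (chartField X x₀) e.target := contDiffOn_chartField hX x₀
  obtain ⟨d, hd, hball⟩ := Metric.nhds_basis_closedBall.mem_iff.1 (hto.mem_nhds hz₀t)
  -- The cut-off makes the coordinate field global and compactly supported without changing it on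
  -- the ball of radius `d / 2`, where the flow lines are kept for short times by `hnear`.
  let χ : ContDiffBump z₀ := ⟨d / 2, d, half_pos hd, half_lt_self hd⟩
  set f : E → E := fun z => χ z • chartField X x₀ z with hf
  have hχs : tsupport χ ⊆ e.target := by rw [χ.tsupport_eq]; exact hball
  have hfs : ContDiff ℝ ∞ f := by
    rw [contDiff_iff_contDiffAt]
    intro z
    by_cases hz : z ∈ tsupport χ
    · exact χ.contDiffAt.smul ((hf₀ z (hχs hz)).contDiffAt (hto.mem_nhds (hχs hz)))
    · have : f =ᶠ[nhds z] fun _ => 0 := by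
        filter_upwards [notMem_tsupport_iff_eventuallyEq.1 hz] with y hy
        simp [hf, hy]
      exact contDiffAt_const.congr_of_eventuallyEq this
  have hfc : HasCompactSupport f := χ.hasCompactSupport.smul_right
  obtain ⟨ρ, hρs, r, hr, hρ⟩ := exists_local_flow hfs hfc z₀
  have hρ0 : ρ (0, z₀) = z₀ := (hρ z₀ (Metric.mem_ball_self hr)).1
  have hnear : ∀ᶠ p in nhds ((0 : ℝ), z₀), ρ p ∈ Metric.ball z₀ (d / 2) := by
    apply hρs.continuousAt.eventually_mem
    rw [hρ0]
    exact Metric.ball_mem_nhds _ (half_pos hd)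
  obtain ⟨η, hη, hηb⟩ := Metric.eventually_nhds_iff_ball.1 hnear
  have hmem : ∀ t z, |t| < η → z ∈ Metric.ball z₀ η → ρ (t, z) ∈ Metric.ball z₀ (d / 2) := by
    intro t z ht hz
    apply hηb
    simp only [Metric.mem_ball, Prod.dist_eq, max_lt_iff]
    exact ⟨by simpa using ht, hz⟩
  have hsub : Metric.ball z₀ (d / 2) ⊆ e.target := fun z hz =>
    hball (Metric.closedBall_subset_closedBall (half_le_self hd.le) (Metric.ball_subset_closedBall hz))
  have hes : ContMDiffAt 𝓘(ℝ, E) 𝓘(ℝ, E) ∞ e x₀ := contMDiffAt_extChartAt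
  refine ⟨fun p => e.symm (ρ (p.1, e p.2)), ?_, min r η, by positivity,
    e.source ∩ e ⁻¹' Metric.ball z₀ (min r η), ?_, ?_⟩
  · have h1 : ContMDiffAt (𝓘(ℝ, ℝ).prod 𝓘(ℝ, E)) 𝓘(ℝ, ℝ × E) ∞
        (fun p : ℝ × M => (p.1, e p.2)) (0, x₀) :=
      contMDiffAt_fst.prodMk_space (hes.comp (0, x₀) contMDiffAt_snd)
    have h2 : ContMDiffAt 𝓘(ℝ, ℝ × E) 𝓘(ℝ, E) ∞ ρ (0, z₀) := hρs.contMDiffAt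
    have h3 : ContMDiffAt 𝓘(ℝ, E) 𝓘(ℝ, E) ∞ e.symm (ρ (0, z₀)) := by
      rw [hρ0]
      exact (contMDiffOn_extChartAt_symm x₀).contMDiffAt (hto.mem_nhds hz₀t)
    exact ContMDiffAt.comp (0, x₀) h3 (ContMDiffAt.comp (0, x₀) h2 h1)
  · exact Filter.inter_mem (extChartAt_source_mem_nhds x₀)
      ((continuousAt_extChartAt x₀).preimage_mem_nhds (Metric.ball_mem_nhds _ (by positivity)))
  · rintro x ⟨hxs, hxb⟩
    have hxr : e x ∈ Metric.ball z₀ r := Metric.ball_subset_ball (min_le_left _ _) hxb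
    have hxη : e x ∈ Metric.ball z₀ η := Metric.ball_subset_ball (min_le_right _ _) hxb
    refine ⟨by simp only [(hρ _ hxr).1]; exact e.left_inv hxs, fun t ht => ?_⟩
    have htr : t ∈ Ioo (-r) r := by
      have := lt_min_iff.1 (abs_lt.2 ht); exact abs_lt.1 this.1
    have htη : |t| < η := (lt_min_iff.1 (abs_lt.2 ht)).2
    have hb := hmem t (e x) htη hxη
    have hder := (hρ _ hxr).2 t htr
    have hfeq : f (ρ (t, e x)) = chartField X x₀ (ρ (t, e x)) := by
      simp only [hf]
      rw [χ.one_of_mem_closedBall (Metric.ball_subset_closedBall hb), one_smul]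
    rw [hfeq] at hder
    have hm := (mdifferentiableAt_extChartAt_symm (hsub hb)).hasMFDerivAt.comp t
      hder.hasFDerivAt.hasMFDerivAt
    refine HasMFDerivAt.hasMFDerivWithinAt (hm.congr_mfderiv ?_)
    refine ContinuousLinearMap.ext fun q => ?_
    refine (ContinuousLinearMap.map_smul (mfderiv 𝓘(ℝ, E) 𝓘(ℝ, E) e.symm (ρ (t, e x))) q
      (chartField (E := E) X x₀ (ρ (t, e x)))).trans ?_
    exact congrArg (fun v => (show ℝ from q) • v) (mfderiv_chartField X (hsub hb))

/-- A smooth vector field on a compact manifold generates a smooth global flow. -/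
theorem exists_flow_of_compactSpace [FiniteDimensional ℝ E] [T2Space M] [CompactSpace M]
    {X : ∀ x : M, TangentSpace 𝓘(ℝ, E) x}
    (hX : ContMDiff 𝓘(ℝ, E) 𝓘(ℝ, E).tangent ∞ (fun x => (⟨x, X x⟩ : TangentBundle 𝓘(ℝ, E) M))) :
    ∃ φ : ℝ → M → M,
      ContMDiff (𝓘(ℝ, ℝ).prod 𝓘(ℝ, E)) 𝓘(ℝ, E) ∞ (fun p : ℝ × M => φ p.1 p.2) ∧
      (∀ x, φ 0 x = x) ∧ (∀ s t x, φ (s + t) x = φ s (φ t x)) ∧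
      ∀ x, IsMIntegralCurve (fun t => φ t x) X := by
  have : CompleteSpace E := FiniteDimensional.complete ℝ E
  have hX1 : ContMDiff 𝓘(ℝ, E) 𝓘(ℝ, E).tangent 1
      (fun x => (⟨x, X x⟩ : TangentBundle 𝓘(ℝ, E) M)) := hX.of_le (by simp)
  choose r hrs ε hε U hU hr using exists_local_mflow hX
  obtain ⟨T, hT⟩ := isCompact_univ.elim_nhds_subcover U fun x _ => hU x
  -- A finite subcover gives one existence time for all starting points; with uniqueness, such
  -- curves extend to all times.
  obtain ⟨δ, hδ, hδε⟩ : ∃ δ > 0, ∀ x ∈ T, δ ≤ ε x := by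
    rcases T.eq_empty_or_nonempty with rfl | hne
    · exact ⟨1, one_pos, by simp⟩
    · obtain ⟨y, hy, hmin⟩ := T.exists_min_image ε hne
      exact ⟨ε y, hε y, hmin⟩
  have hloc : ∀ x : M, ∃ γ : ℝ → M, γ 0 = x ∧ IsMIntegralCurveOn γ X (Ioo (-δ) δ) := by
    intro x
    have hx := hT.2 (mem_univ x)
    simp only [mem_iUnion] at hx
    obtain ⟨y, hy, hxy⟩ := hx
    have := hδε y hy
    exact ⟨fun t => r y (t, x), (hr y x hxy).1,
      (hr y x hxy).2.mono (Ioo_subset_Ioo (by linarith) this)⟩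
  choose γ hγ0 hγ using exists_isMIntegralCurve_of_isMIntegralCurveOn hX1 hδ hloc
  set φ : ℝ → M → M := fun t x => γ x t with hφ
  have hgroup : ∀ s t x, φ (s + t) x = φ s (φ t x) := by
    intro s t x
    have h := isMIntegralCurve_Ioo_eq_of_contMDiff_boundaryless (t₀ := 0) hX1
      ((hγ x).comp_add t) (hγ (γ x t)) (by simp [hγ0])
    exact congrFun h s
  have hsm0 : ∀ x, ContMDiffAt (𝓘(ℝ, ℝ).prod 𝓘(ℝ, E)) 𝓘(ℝ, E) ∞
      (fun p : ℝ × M => φ p.1 p.2) (0, x) := by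
    intro x
    refine (hrs x).congr_of_eventuallyEq ?_
    have hn : Ioo (-ε x) (ε x) ×ˢ U x ∈ nhds ((0 : ℝ), x) :=
      prod_mem_nhds (Ioo_mem_nhds (by linarith [hε x]) (hε x)) (hU x)
    filter_upwards [hn] with p hp
    have h := isMIntegralCurveOn_Ioo_eqOn_of_contMDiff_boundaryless (t₀ := 0)
      ⟨by linarith [hε x], hε x⟩ hX1 ((hγ p.2).isMIntegralCurveOn _) (hr x p.2 hp.2).2
      (by rw [hγ0, (hr x p.2 hp.2).1])
    exact h hp.1
  refine ⟨φ, ?_, hγ0, hgroup, hγ⟩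
  rw [contMDiff_infty]
  -- For finite `m`, unlike for `∞`, being of class `C^m` at a point is an open condition.
  -- Compactness then gives smoothness of order `m` for all `|t| < η`, with `η` depending on `m`.
  intro m
  obtain ⟨η, hη, hηs⟩ : ∃ η > (0 : ℝ), ∀ t x, |t| < η →
      ContMDiffAt (𝓘(ℝ, ℝ).prod 𝓘(ℝ, E)) 𝓘(ℝ, E) m (fun p : ℝ × M => φ p.1 p.2) (t, x) := by
    have hev : ∀ x ∈ (univ : Set M), ∀ᶠ p in nhds ((0 : ℝ), x),
        ContMDiffAt (𝓘(ℝ, ℝ).prod 𝓘(ℝ, E)) 𝓘(ℝ, E) m (fun p : ℝ × M => φ p.1 p.2) p := by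
      intro x _
      exact (contMDiffAt_iff_contMDiffAt_nhds (by simp)).1 ((hsm0 x).of_le (by
        exact_mod_cast le_top))
    have h := isCompact_univ.eventually_forall_of_forall_eventually (x₀ := (0 : ℝ))
      (P := fun t x => ContMDiffAt (𝓘(ℝ, ℝ).prod 𝓘(ℝ, E)) 𝓘(ℝ, E) m
        (fun p : ℝ × M => φ p.1 p.2) (t, x)) hev
    obtain ⟨η, hη, hb⟩ := Metric.eventually_nhds_iff.1 h
    exact ⟨η, hη, fun t x ht => hb (by simpa using ht) x (mem_univ x)⟩
  -- The identity φ_t = φ_{t/2} ∘ φ_{t/2} doubles the time interval on which the flow is known to be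
  -- `C^m`.
  have hdouble : ∀ k : ℕ, ∀ t x, |t| < 2 ^ k * η →
      ContMDiffAt (𝓘(ℝ, ℝ).prod 𝓘(ℝ, E)) 𝓘(ℝ, E) m (fun p : ℝ × M => φ p.1 p.2) (t, x) := by
    intro k
    induction k with
    | zero => simpa using hηs
    | succ k ih =>
      intro t x ht
      have ht2 : |t / 2| < 2 ^ k * η := by
        rw [abs_div, abs_two, div_lt_iff₀ two_pos]
        rw [pow_succ] at ht
        linarith
      have hhalf : ContMDiffAt (𝓘(ℝ, ℝ).prod 𝓘(ℝ, E)) 𝓘(ℝ, ℝ) m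
          (fun p : ℝ × M => p.1 / 2) (t, x) := by
        have : ContDiff ℝ m (fun t : ℝ => t / 2) := by fun_prop
        exact this.contMDiff.contMDiffAt.comp (t, x) contMDiffAt_fst
      have h1 : ContMDiffAt (𝓘(ℝ, ℝ).prod 𝓘(ℝ, E)) 𝓘(ℝ, E) m
          (fun p : ℝ × M => φ (p.1 / 2) p.2) (t, x) :=
        ContMDiffAt.comp (t, x) (ih (t / 2) x ht2) (hhalf.prodMk contMDiffAt_snd)
      have h2 : ContMDiffAt (𝓘(ℝ, ℝ).prod 𝓘(ℝ, E)) 𝓘(ℝ, E) m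
          (fun p : ℝ × M => φ (p.1 / 2) (φ (p.1 / 2) p.2)) (t, x) :=
        ContMDiffAt.comp (t, x) (ih (t / 2) (φ (t / 2) x) ht2) (hhalf.prodMk h1)
      refine h2.congr_of_eventuallyEq (Filter.Eventually.of_forall fun p => ?_)
      simp only [← hgroup, add_halves]
  rintro ⟨t, x⟩
  obtain ⟨k, hk⟩ := pow_unbounded_of_one_lt (|t| / η) one_lt_two
  exact hdouble k t x ((div_lt_iff₀ hη).1 hk)

end ManifoldFlow

end

noncomputable section

namespace ContactGeometry

/-! ### The Reeb vector in a vector space -/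

section ReebVector

variable {E : Type*} [NormedAddCommGroup E] [NormedSpace ℝ E]

theorem dForm_swap (β : E → E →L[ℝ] ℝ) (z u v : E) : dForm β z u v = -dForm β z v u := by
  simp [dForm]

theorem dForm_smul_left (β : E → E →L[ℝ] ℝ) (z : E) (c : ℝ) (u v : E) :
    dForm β z (c • u) v = c * dForm β z u v := by
  simp [dForm]; ring

theorem dForm_sub_left (β : E → E →L[ℝ] ℝ) (z u u' v : E) :
    dForm β z (u - u') v = dForm β z u v - dForm β z u' v := by
  simp [dForm]; ring

/-- The non-degeneracy of `dβ` on `ker β` at the point `z`. -/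
def NondegenerateAt (β : E → E →L[ℝ] ℝ) (z : E) : Prop :=
  ∀ u, β z u = 0 → (∀ v, β z v = 0 → dForm β z u v = 0) → u = 0

set_option synthInstance.maxHeartbeats 200000 in
/-- The operator `u ↦ dβ(u, ·) + β(u) β`, which is invertible for a contact form `β` and maps the
Reeb vector to `β`. -/
def reebOperator (β : E → E →L[ℝ] ℝ) (z : E) : E →L[ℝ] E →L[ℝ] ℝ :=
  fderiv ℝ β z - (fderiv ℝ β z).flip + (β z).smulRight (β z)

set_option synthInstance.maxHeartbeats 200000 in
theorem reebOperator_apply (β : E → E →L[ℝ] ℝ) (z u v : E) :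
    reebOperator β z u v = dForm β z u v + β z u * β z v := by
  simp [reebOperator, dForm]

/-- The Reeb vector of a one-form on a vector space. -/
def reebVector (β : E → E →L[ℝ] ℝ) (z : E) : E :=
  (reebOperator β z).inverse (β z)

/-- An alternating bilinear form on an odd-dimensional space has a non-trivial kernel. -/
theorem exists_ne_zero_dForm_eq_zero {n : ℕ} (β : Model n → Model n →L[ℝ] ℝ) (z : Model n) :
    ∃ u ≠ 0, ∀ v, dForm β z u v = 0 := by
  let b := (EuclideanSpace.basisFun (Fin (2 * n + 1)) ℝ).toBasis
  let A : Matrix (Fin (2 * n + 1)) (Fin (2 * n + 1)) ℝ := fun i j => dForm β z (b i) (b j)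
  have hA : A.transpose = -A := by
    ext i j
    exact dForm_swap β z _ _
  have hdet : A.det = 0 := by
    have h := congrArg Matrix.det hA
    -- Odd dimension: the determinant equals its own negative.
    rw [Matrix.det_transpose, Matrix.det_neg, Fintype.card_fin, Odd.neg_one_pow ⟨n, rfl⟩] at h
    linarith
  obtain ⟨c, hc, hAc⟩ := Matrix.exists_mulVec_eq_zero_iff.2 hdet
  refine ⟨b.equivFun.symm c, b.equivFun.symm.map_ne_zero_iff.2 hc, fun v => ?_⟩
  rw [dForm_swap, neg_eq_zero]
  have hlin : (fderiv ℝ β z).flip (b.equivFun.symm c) - fderiv ℝ β z (b.equivFun.symm c) = 0 := by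
    apply ContinuousLinearMap.coe_injective
    refine b.ext fun i => ?_
    have := congrFun hAc i
    simp only [Matrix.mulVec, dotProduct, Pi.zero_apply, A, dForm] at this
    refine Eq.trans ?_ this
    simp only [Module.Basis.equivFun_symm_apply, map_sum, map_smul]
    simp [← Finset.sum_sub_distrib, mul_sub, mul_comm]
  have := congrArg (fun f => f v) hlin
  simpa [dForm] using this

/-- A non-zero kernel vector of `dβ` cannot lie in `ker β`, by non-degeneracy, so it can be
rescaled. -/
theorem exists_reeb {n : ℕ} {β : Model n → Model n →L[ℝ] ℝ} {z : Model n}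
    (h : NondegenerateAt β z) : ∃ R, β z R = 1 ∧ ∀ v, dForm β z R v = 0 := by
  obtain ⟨u, hu, huv⟩ := exists_ne_zero_dForm_eq_zero β z
  have hne : β z u ≠ 0 := fun h0 => hu (h u h0 fun v _ => huv v)
  refine ⟨(β z u)⁻¹ • u, by simp [hne], fun v => ?_⟩
  rw [dForm_smul_left, huv, mul_zero]

theorem reeb_unique {β : E → E →L[ℝ] ℝ} {z : E} (h : NondegenerateAt β z) {R R' : E}
    (hR : β z R = 1) (hR' : β z R' = 1) (hd : ∀ v, dForm β z R v = 0)
    (hd' : ∀ v, dForm β z R' v = 0) : R = R' := by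
  refine sub_eq_zero.1 (h _ (by simp [hR, hR']) fun v _ => ?_)
  rw [dForm_sub_left, hd, hd', sub_zero]

-- Injectivity suffices by dimension. If `u` is in the kernel, evaluating on the Reeb vector gives
-- `β z u = 0`, and non-degeneracy then gives `u = 0`. Writing the Reeb vector through an operator
-- inverse is what makes its smooth dependence on `z` accessible.
set_option synthInstance.maxHeartbeats 200000 in
theorem isInvertible_reebOperator {n : ℕ} {β : Model n → Model n →L[ℝ] ℝ} {z : Model n}
    (h : NondegenerateAt β z) : (reebOperator β z).IsInvertible := by
  obtain ⟨R, hR, hRd⟩ := exists_reeb h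
  have hinj : Function.Injective (reebOperator β z : Model n →ₗ[ℝ] Model n →L[ℝ] ℝ) := by
    refine (injective_iff_map_eq_zero _).2 fun u hu => ?_
    have hu' : ∀ v, dForm β z u v + β z u * β z v = 0 := fun v => by
      rw [← reebOperator_apply]
      exact congrArg (fun f => f v) hu
    have h0 : β z u = 0 := by
      have := hu' R
      rw [dForm_swap, hRd, hR] at this
      simpa using this
    exact h u h0 fun v _ => by simpa [h0] using hu' v
  have hdim : Module.finrank ℝ (Model n) = Module.finrank ℝ (Model n →L[ℝ] ℝ) := by
    rw [← (LinearMap.toContinuousLinearMap (𝕜 := ℝ) (E := Model n) (F' := ℝ)).finrank_eq]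
    exact (Subspace.dual_finrank_eq (K := ℝ) (V := Model n)).symm
  exact ⟨(LinearMap.linearEquivOfInjective _ hinj hdim).toContinuousLinearEquiv, by ext; rfl⟩

theorem reebVector_spec {n : ℕ} {β : Model n → Model n →L[ℝ] ℝ} {z : Model n}
    (h : NondegenerateAt β z) :
    β z (reebVector β z) = 1 ∧ ∀ v, dForm β z (reebVector β z) v = 0 := by
  obtain ⟨R, hR, hRd⟩ := exists_reeb h
  have : reebVector β z = R := by
    refine (isInvertible_reebOperator h).inverse_apply_eq.2 ?_
    ext v
    rw [reebOperator_apply, hRd, hR]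
    simp
  rw [this]
  exact ⟨hR, hRd⟩

set_option synthInstance.maxHeartbeats 200000 in
theorem contDiffAt_clm_flip {f : E → E →L[ℝ] E →L[ℝ] ℝ} {z : E} (hf : ContDiffAt ℝ ∞ f z) :
    ContDiffAt ℝ ∞ (fun y => (f y).flip) z := by
  let flipCLM : (E →L[ℝ] E →L[ℝ] ℝ) →L[ℝ] (E →L[ℝ] E →L[ℝ] ℝ) :=
    (ContinuousLinearMap.flipₗᵢ ℝ E E ℝ).toContinuousLinearEquiv.toContinuousLinearMap
  exact (ContinuousLinearMap.contDiff (F := E →L[ℝ] E →L[ℝ] ℝ) flipCLM).contDiffAt.comp z hf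

set_option synthInstance.maxHeartbeats 200000 in
theorem contDiffAt_reebVector {n : ℕ} {β : Model n → Model n →L[ℝ] ℝ} {z : Model n}
    (hβ : ContDiffAt ℝ ∞ β z) (h : NondegenerateAt β z) :
    ContDiffAt ℝ ∞ (reebVector β) z := by
  have hf : ContDiffAt ℝ ∞ (fderiv ℝ β) z := hβ.fderiv_right (by simp)
  have hop : ContDiffAt ℝ ∞ (reebOperator β) z := by
    refine (hf.sub ?_).add (hβ.smulRight hβ)
    exact contDiffAt_clm_flip hf
  obtain ⟨A, hA⟩ := isInvertible_reebOperator h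
  have hinv : ContDiffAt ℝ ∞ (ContinuousLinearMap.inverse (R := ℝ) (M := Model n)
      (M₂ := Model n →L[ℝ] ℝ)) (reebOperator β z) := by
    rw [← hA]
    exact contDiffAt_map_inverse A
  exact (hinv.comp z hop).clm_apply hβ

/-- Naturality of the exterior derivative of one-forms. -/
theorem dForm_pullback {β β₀ : E → E →L[ℝ] ℝ} {ψ : E → E} {z : E}
    (hβ : DifferentiableAt ℝ β (ψ z)) (hψ : ContDiffAt ℝ ∞ ψ z)
    (h : β₀ =ᶠ[nhds z] fun y => (β (ψ y)).comp (fderiv ℝ ψ y)) (u v : E) :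
    dForm β₀ z u v = dForm β (ψ z) (fderiv ℝ ψ z u) (fderiv ℝ ψ z v) := by
  have hψd : HasFDerivAt ψ (fderiv ℝ ψ z) z := (hψ.differentiableAt (by simp)).hasFDerivAt
  have hψ' : HasFDerivAt (fderiv ℝ ψ) (fderiv ℝ (fderiv ℝ ψ) z) z :=
    ((hψ.fderiv_right (m := ∞) (by simp)).differentiableAt (by simp)).hasFDerivAt
  have hder := ((hβ.hasFDerivAt.comp z hψd).clm_comp hψ').congr_of_eventuallyEq h
  -- The second-derivative terms of ψ are symmetric in `u`, `v` and cancel in the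
  -- antisymmetrisation.
  have hsymm := hψ.isSymmSndFDerivAt (by
    rw [minSmoothness_of_isRCLikeNormedField]; exact ENat.LEInfty.out) u v
  simp only [dForm, hder.fderiv]
  simp [hsymm]

end ReebVector

end ContactGeometry

end

noncomputable section

/-! ### Chart changes and the Reeb vector field on a manifold -/

section ChartChange

variable {E : Type*} [NormedAddCommGroup E] [NormedSpace ℝ E]
  {M : Type*} [TopologicalSpace M] [ChartedSpace E M] [IsManifold 𝓘(ℝ, E) ∞ M]

theorem contDiffAt_chart_change {x₀ x₁ : M} {z : E} (hz : z ∈ (extChartAt 𝓘(ℝ, E) x₀).target)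
    (hz' : (extChartAt 𝓘(ℝ, E) x₀).symm z ∈ (extChartAt 𝓘(ℝ, E) x₁).source) :
    ContDiffAt ℝ ∞ (extChartAt 𝓘(ℝ, E) x₁ ∘ (extChartAt 𝓘(ℝ, E) x₀).symm) z := by
  rw [← contMDiffAt_iff_contDiffAt]
  exact (contMDiffAt_extChartAt' (by rwa [extChartAt_source] at hz')).comp z
    ((contMDiffOn_extChartAt_symm x₀).contMDiffAt ((isOpen_extChartAt_target x₀).mem_nhds hz))

theorem mfderiv_extChartAt_symm_chart_change {x₀ x₁ : M} {z : E}
    (hz : z ∈ (extChartAt 𝓘(ℝ, E) x₀).target)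
    (hz' : (extChartAt 𝓘(ℝ, E) x₀).symm z ∈ (extChartAt 𝓘(ℝ, E) x₁).source) (v : E) :
    (show E from mfderiv 𝓘(ℝ, E) 𝓘(ℝ, E) (extChartAt 𝓘(ℝ, E) x₀).symm z v) =
      mfderiv 𝓘(ℝ, E) 𝓘(ℝ, E) (extChartAt 𝓘(ℝ, E) x₁).symm
        (extChartAt 𝓘(ℝ, E) x₁ ((extChartAt 𝓘(ℝ, E) x₀).symm z))
        (fderiv ℝ (extChartAt 𝓘(ℝ, E) x₁ ∘ (extChartAt 𝓘(ℝ, E) x₀).symm) z v : E) := by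
  set e₀ := extChartAt 𝓘(ℝ, E) x₀
  set e₁ := extChartAt 𝓘(ℝ, E) x₁
  have hψ : HasMFDerivAt 𝓘(ℝ, E) 𝓘(ℝ, E) (e₁ ∘ e₀.symm) z (fderiv ℝ (e₁ ∘ e₀.symm) z) :=
    ((contDiffAt_chart_change hz hz').differentiableAt (by simp)).hasFDerivAt.hasMFDerivAt
  have h1 := (mdifferentiableAt_extChartAt_symm (x₀ := x₁) (z := e₁ (e₀.symm z))
    (e₁.map_source hz')).hasMFDerivAt.comp z hψ
  have hev : e₀.symm =ᶠ[nhds z] e₁.symm ∘ (e₁ ∘ e₀.symm) := by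
    have h2 : ∀ᶠ y in nhds z, e₀.symm y ∈ e₁.source :=
      ((contMDiffOn_extChartAt_symm (n := ∞) x₀).contMDiffAt
        ((isOpen_extChartAt_target x₀).mem_nhds hz)).continuousAt.eventually_mem
          ((isOpen_extChartAt_source x₁).mem_nhds hz')
    filter_upwards [h2] with y hy
    exact (e₁.left_inv hy).symm
  have h3 := (h1.congr_of_eventuallyEq hev).mfderiv
  exact congrArg (fun A : E →L[ℝ] E => A v) h3

end ChartChange

namespace ContactGeometry

variable {n : ℕ} {M : Type*} [TopologicalSpace M] [ChartedSpace (Model n) M]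

theorem ContactForm.contDiffAt_chartForm (α : ContactForm n M) {x₀ : M} {z : Model n}
    (hz : z ∈ (extChartAt (𝓡 (2 * n + 1)) x₀).target) :
    ContDiffAt ℝ ∞ (chartForm α.toFun x₀) z :=
  (α.smooth x₀ z hz).contDiffAt ((isOpen_extChartAt_target x₀).mem_nhds hz)

theorem ContactForm.nondegenerateAt (α : ContactForm n M) {x₀ : M} {z : Model n}
    (hz : z ∈ (extChartAt (𝓡 (2 * n + 1)) x₀).target) :
    NondegenerateAt (chartForm α.toFun x₀) z :=
  α.nondegenerate x₀ z hz

/-- The Reeb vector field of a contact form. -/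
def ContactForm.reebField (α : ContactForm n M) (x : M) : TangentSpace (𝓡 (2 * n + 1)) x :=
  (mfderiv 𝓘(ℝ, Model n) (𝓡 (2 * n + 1)) (extChartAt (𝓡 (2 * n + 1)) x).symm
    (extChartAt (𝓡 (2 * n + 1)) x x)
    (reebVector (E := Model n) (chartForm α.toFun x) (extChartAt (𝓡 (2 * n + 1)) x x)) : Model n)

theorem ContactForm.apply_reebField (α : ContactForm n M) (x : M) :
    α.toFun x (α.reebField x) = 1 := by
  have hz := mem_extChartAt_target (I := 𝓡 (2 * n + 1)) x
  have h := (reebVector_spec (α.nondegenerateAt (x₀ := x) hz)).1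
  let a : M → Model n →L[ℝ] ℝ := α.toFun
  have hx := extChartAt_to_inv (I := 𝓡 (2 * n + 1)) x
  have h' : a ((extChartAt (𝓡 (2 * n + 1)) x).symm (extChartAt (𝓡 (2 * n + 1)) x x))
      (α.reebField x) = 1 := h
  rw [hx] at h'
  exact h'

variable [IsManifold (𝓡 (2 * n + 1)) ∞ M]

theorem chartForm_chart_change (α : ∀ x : M, TangentSpace (𝓡 (2 * n + 1)) x →L[ℝ] ℝ)
    {x₀ x₁ : M} {z : Model n} (hz : z ∈ (extChartAt (𝓡 (2 * n + 1)) x₀).target)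
    (hz' : (extChartAt (𝓡 (2 * n + 1)) x₀).symm z ∈ (extChartAt (𝓡 (2 * n + 1)) x₁).source) :
    chartForm α x₀ z =
      (chartForm α x₁ ((extChartAt (𝓡 (2 * n + 1)) x₁ ∘ (extChartAt (𝓡 (2 * n + 1)) x₀).symm) z)).comp
        (fderiv ℝ (extChartAt (𝓡 (2 * n + 1)) x₁ ∘ (extChartAt (𝓡 (2 * n + 1)) x₀).symm) z) := by
  set e₀ := extChartAt (𝓡 (2 * n + 1)) x₀
  set e₁ := extChartAt (𝓡 (2 * n + 1)) x₁
  ext v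
  have h := mfderiv_extChartAt_symm_chart_change hz hz' v
  have hp : e₁.symm (e₁ (e₀.symm z)) = e₀.symm z := e₁.left_inv hz'
  let a : M → Model n →L[ℝ] ℝ := α
  show a (e₀.symm z) _ = a (e₁.symm (e₁ (e₀.symm z))) _
  rw [hp]
  exact congrArg (a (e₀.symm z)) h

theorem chartForm_eventually_chart_change (α : ∀ x : M, TangentSpace (𝓡 (2 * n + 1)) x →L[ℝ] ℝ)
    {x₀ x₁ : M} {z : Model n} (hz : z ∈ (extChartAt (𝓡 (2 * n + 1)) x₀).target)
    (hz' : (extChartAt (𝓡 (2 * n + 1)) x₀).symm z ∈ (extChartAt (𝓡 (2 * n + 1)) x₁).source) :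
    chartForm α x₀ =ᶠ[nhds z] fun y =>
      (chartForm α x₁ ((extChartAt (𝓡 (2 * n + 1)) x₁ ∘ (extChartAt (𝓡 (2 * n + 1)) x₀).symm) y)).comp
        (fderiv ℝ (extChartAt (𝓡 (2 * n + 1)) x₁ ∘ (extChartAt (𝓡 (2 * n + 1)) x₀).symm) y) := by
  have h2 : ∀ᶠ y in nhds z, (extChartAt (𝓡 (2 * n + 1)) x₀).symm y ∈
      (extChartAt (𝓡 (2 * n + 1)) x₁).source :=
    ((contMDiffOn_extChartAt_symm (n := ∞) x₀).contMDiffAt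
      ((isOpen_extChartAt_target x₀).mem_nhds hz)).continuousAt.eventually_mem
        ((isOpen_extChartAt_source x₁).mem_nhds hz')
  filter_upwards [h2, (isOpen_extChartAt_target x₀).mem_nhds hz] with y hy hy'
  exact chartForm_chart_change α hy' hy

/-- The field is defined at each point through the preferred chart of that point, which varies with
the point. Any other chart gives the same vector because `dForm` is natural under chart changes and
the Reeb vector is unique. This allows smoothness to be checked in a single fixed chart. -/
theorem ContactForm.reebField_eq (α : ContactForm n M) {x₀ : M} {z : Model n}
    (hz : z ∈ (extChartAt (𝓡 (2 * n + 1)) x₀).target) :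
    (show Model n from α.reebField ((extChartAt (𝓡 (2 * n + 1)) x₀).symm z)) =
      mfderiv 𝓘(ℝ, Model n) (𝓡 (2 * n + 1)) (extChartAt (𝓡 (2 * n + 1)) x₀).symm z
        (reebVector (E := Model n) (chartForm α.toFun x₀) z) := by
  set e₀ := extChartAt (𝓡 (2 * n + 1)) x₀ with he₀
  set x₁ := e₀.symm z with hx₁
  set e₁ := extChartAt (𝓡 (2 * n + 1)) x₁ with he₁
  have hz' : e₀.symm z ∈ e₁.source := mem_extChartAt_source x₁
  set ψ := e₁ ∘ e₀.symm with hψ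
  have hψz : ψ z ∈ e₁.target := e₁.map_source hz'
  have hchain : ∀ v : Model n, (show Model n from
      mfderiv 𝓘(ℝ, Model n) (𝓡 (2 * n + 1)) e₀.symm z v) =
      mfderiv 𝓘(ℝ, Model n) (𝓡 (2 * n + 1)) e₁.symm (ψ z) (fderiv ℝ ψ z v : Model n) :=
    fun v => mfderiv_extChartAt_symm_chart_change hz hz' v
  have hb₀ := (isInvertible_mfderiv_extChartAt_symm (x₀ := x₀) hz).bijective
  have hb₁ := (isInvertible_mfderiv_extChartAt_symm (x₀ := x₁) hψz).bijective
  -- The chart change has surjective derivative, so testing `dβ` on image vectors is enough.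
  have hsurj : ∀ w : Model n, ∃ w', fderiv ℝ ψ z w' = w := by
    intro w
    obtain ⟨w', hw'⟩ := hb₀.2
      (show Model n from mfderiv 𝓘(ℝ, Model n) (𝓡 (2 * n + 1)) e₁.symm (ψ z) w)
    exact ⟨w', hb₁.1 ((hchain w').symm.trans hw')⟩
  have hspec := reebVector_spec (α.nondegenerateAt (x₀ := x₀) hz)
  have hkey : fderiv ℝ ψ z (reebVector (chartForm α.toFun x₀) z) =
      reebVector (chartForm α.toFun x₁) (ψ z) := by
    have hspec₁ := reebVector_spec (α.nondegenerateAt (x₀ := x₁) hψz)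
    refine reeb_unique (α.nondegenerateAt (x₀ := x₁) hψz) ?_ hspec₁.1 (fun w => ?_) hspec₁.2
    · have h := chartForm_chart_change α.toFun (x₁ := x₁) hz hz'
      have h' := congrArg (fun A : Model n →L[ℝ] ℝ => A (reebVector (chartForm α.toFun x₀) z)) h
      exact h'.symm.trans hspec.1
    · obtain ⟨w', rfl⟩ := hsurj w
      rw [← dForm_pullback ((α.contDiffAt_chartForm (x₀ := x₁) hψz).differentiableAt (by simp))
        (contDiffAt_chart_change hz hz')
        (chartForm_eventually_chart_change α.toFun (x₁ := x₁) hz hz')]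
      exact hspec.2 w'
  refine Eq.trans ?_ (hchain (reebVector (chartForm α.toFun x₀) z)).symm
  rw [hkey]
  rfl

theorem ContactForm.contMDiff_reebField (α : ContactForm n M) :
    ContMDiff (𝓡 (2 * n + 1)) (𝓡 (2 * n + 1)).tangent ∞
      (fun x => (⟨x, α.reebField x⟩ : TangentBundle (𝓡 (2 * n + 1)) M)) := by
  intro x₀
  set e₀ := extChartAt (𝓡 (2 * n + 1)) x₀ with he₀
  let V : ∀ z : Model n, TangentSpace 𝓘(ℝ, Model n) z := reebVector (chartForm α.toFun x₀)
  have hz := mem_extChartAt_target (I := 𝓡 (2 * n + 1)) x₀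
  have hV : ContMDiffAt 𝓘(ℝ, Model n) 𝓘(ℝ, Model n).tangent ∞
      (fun z => (⟨z, V z⟩ : TangentBundle 𝓘(ℝ, Model n) (Model n))) (e₀ x₀) := by
    have := contDiffAt_reebVector (α.contDiffAt_chartForm hz) (α.nondegenerateAt (x₀ := x₀) hz)
    exact contMDiffAt_vectorSpace_iff_contDiffAt.2 this
  have h := ContMDiffAt.mpullback_vectorField_preimage (V := V) (m := ∞) (n := ∞) (x₀ := x₀)
    (f := e₀) hV contMDiffAt_extChartAt
    (isInvertible_mfderiv_extChartAt (mem_extChartAt_source x₀)) (by simp)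
  refine h.congr_of_eventuallyEq ?_
  filter_upwards [extChartAt_source_mem_nhds (I := 𝓡 (2 * n + 1)) x₀] with y hy
  have hyt : e₀ y ∈ e₀.target := e₀.map_source hy
  suffices hs : α.reebField y = VectorField.mpullback (𝓡 (2 * n + 1)) 𝓘(ℝ, Model n) e₀ V y by
    rw [hs]
  symm
  rw [VectorField.mpullback_apply]
  refine (isInvertible_mfderiv_extChartAt hy).inverse_apply_eq.2 ?_
  have hre := α.reebField_eq (x₀ := x₀) hyt
  have hcomp := mfderiv_extChartAt_comp_mfderivWithin_extChartAt_symm' (I := 𝓡 (2 * n + 1)) hy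
  rw [ModelWithCorners.range_eq_univ, mfderivWithin_univ] at hcomp
  have hyy : e₀.symm (e₀ y) = y := e₀.left_inv hy
  let r : M → Model n := α.reebField
  have hre' : r (e₀.symm (e₀ y)) = _ := hre
  rw [hyy] at hre'
  have h2 := congrArg (fun A : Model n →L[ℝ] Model n => A (V (e₀ y))) hcomp
  refine h2.symm.trans ?_
  exact congrArg (mfderiv (𝓡 (2 * n + 1)) 𝓘(ℝ, Model n) e₀ y : Model n →L[ℝ] Model n) hre'.symm

end ContactGeometry

end

noncomputable section

/-! ### Invariance of the contact form under the Reeb flow -/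

namespace ContactGeometry

/-- Infinitesimal form of the invariance of a one-form under the flow of its Reeb vector field. -/
theorem hasDerivAt_pullback_flow {E : Type*} [NormedAddCommGroup E] [NormedSpace ℝ E]
    {β : E → E →L[ℝ] ℝ} {ρ : ℝ × E → E} {V : E → E} {z w : E}
    (hβ : DifferentiableAt ℝ β z) (hρ : ContDiffAt ℝ ∞ ρ (0, z))
    (h0 : ∀ᶠ y in nhds z, ρ (0, y) = y)
    (hV : ∀ᶠ y in nhds z, fderiv ℝ ρ (0, y) (1, 0) = V y)
    (hβV : ∀ᶠ y in nhds z, β y (V y) = 1) (hd : dForm β z (V z) w = 0) :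
    HasDerivAt (fun s => β (ρ (s, z)) (fderiv ℝ ρ (s, z) (0, w))) 0 0 := by
  have hρ0 : ρ (0, z) = z := h0.self_of_nhds
  have hρd : HasFDerivAt ρ (fderiv ℝ ρ (0, z)) (0, z) :=
    (hρ.differentiableAt (by simp)).hasFDerivAt
  have hρdd : HasFDerivAt (fderiv ℝ ρ) (fderiv ℝ (fderiv ℝ ρ) (0, z)) (0, z) :=
    ((hρ.fderiv_right (m := ∞) (by simp)).differentiableAt (by simp)).hasFDerivAt
  have hline : HasDerivAt (fun s : ℝ => (s, z)) ((1 : ℝ), (0 : E)) 0 :=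
    (hasDerivAt_id (0 : ℝ)).prodMk (hasDerivAt_const (0 : ℝ) z)
  have hc : HasDerivAt (fun s : ℝ => ρ (s, z)) (V z) 0 := by
    rw [← hV.self_of_nhds]
    exact hρd.comp_hasDerivAt (0 : ℝ) hline
  have hβc : HasDerivAt (fun s : ℝ => β (ρ (s, z))) (fderiv ℝ β z (V z)) 0 := by
    have hβ' : HasFDerivAt β (fderiv ℝ β z) (ρ (0, z)) := by rw [hρ0]; exact hβ.hasFDerivAt
    exact hβ'.comp_hasDerivAt (0 : ℝ) hc
  have hg : HasDerivAt (fun s : ℝ => fderiv ℝ ρ (s, z) (0, w))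
      (fderiv ℝ (fderiv ℝ ρ) (0, z) (1, 0) (0, w)) 0 := by
    have h1 : HasDerivAt (fun s : ℝ => fderiv ℝ ρ (s, z))
        (fderiv ℝ (fderiv ℝ ρ) (0, z) (1, 0)) 0 := hρdd.comp_hasDerivAt (0 : ℝ) hline
    simpa using h1.clm_apply (hasDerivAt_const (0 : ℝ) ((0 : ℝ), w))
  have hg0 : fderiv ℝ ρ (0, z) (0, w) = w := by
    have h1 : HasFDerivAt (fun y => ρ (0, y))
        ((fderiv ℝ ρ (0, z)).comp (.inr ℝ ℝ E)) z :=
      hρd.comp z (hasFDerivAt_prodMk_right (0 : ℝ) z)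
    have h2 : HasFDerivAt (fun y => ρ (0, y)) (.id ℝ E) z :=
      (hasFDerivAt_id z).congr_of_eventuallyEq h0
    have := congrArg (fun A : E →L[ℝ] E => A w) (h1.unique h2)
    simpa using this
  have hVd : HasFDerivAt V ((fderiv ℝ (fderiv ℝ ρ) (0, z)).flip (1, 0) ∘L .inr ℝ ℝ E) z := by
    have h1 : HasFDerivAt (fun y => fderiv ℝ ρ (0, y))
        (fderiv ℝ (fderiv ℝ ρ) (0, z) ∘L .inr ℝ ℝ E) z :=
      hρdd.comp z (hasFDerivAt_prodMk_right (0 : ℝ) z)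
    have h2 := h1.clm_apply (hasFDerivAt_const ((1 : ℝ), (0 : E)) z)
    refine (h2.congr_of_eventuallyEq ?_).congr_fderiv ?_
    · filter_upwards [hV] with y hy using hy.symm
    · ext; simp
  have hβVd := (hβ.hasFDerivAt.clm_apply hVd).congr_of_eventuallyEq
    (f₁ := fun _ => (1 : ℝ)) (by filter_upwards [hβV] with y hy using hy.symm)
  -- Differentiating β(V) = 1 in direction `w` gives Dβ(w)(V) + β(DV w) = 0. The derivative sought
  -- is Dβ(V)(w) + β(DV w), after exchanging the time and space derivatives of `ρ`; the difference
  -- is dβ(V, w) = 0. This is Cartan's formula by hand.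
  have hzero := congrArg (fun A : E →L[ℝ] ℝ => A w)
    (hβVd.unique (hasFDerivAt_const (1 : ℝ) z))
  have hsymm := hρ.isSymmSndFDerivAt (by
    rw [minSmoothness_of_isRCLikeNormedField]; exact ENat.LEInfty.out) (1, 0) (0, w)
  have hmain := hβc.clm_apply hg
  rw [hρ0, hg0, hsymm] at hmain
  simp at hzero
  have hd' : fderiv ℝ β z (V z) w - fderiv ℝ β z w (V z) = 0 := hd
  refine hmain.congr_deriv ?_
  linarith

variable {n : ℕ} {M : Type*} [TopologicalSpace M] [ChartedSpace (Model n) M]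
  [IsManifold (𝓡 (2 * n + 1)) ∞ M]

/-- The flow is read as `ρ` in the chart around `x`, which contains the orbit of `x` for short
times; this is why only the derivative at time zero is treated here. -/
theorem ContactForm.hasDerivAt_pullback_reeb_flow (α : ContactForm n M) {φ : ℝ → M → M}
    (hφ : ContMDiff (𝓘(ℝ, ℝ).prod (𝓡 (2 * n + 1))) (𝓡 (2 * n + 1)) ∞
      (fun p : ℝ × M => φ p.1 p.2))
    (hφ0 : ∀ x, φ 0 x = x) (hφX : ∀ x, IsMIntegralCurve (fun t => φ t x) α.reebField)
    (x : M) (v : TangentSpace (𝓡 (2 * n + 1)) x) :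
    HasDerivAt (fun s => α.toFun (φ s x) (mfderiv (𝓡 (2 * n + 1)) (𝓡 (2 * n + 1)) (φ s) x v))
      0 0 := by
  set e := extChartAt (𝓡 (2 * n + 1)) x with he
  set z := e x with hz
  have hzt : z ∈ e.target := mem_extChartAt_target x
  have hto : IsOpen e.target := isOpen_extChartAt_target x
  set β := chartForm α.toFun x with hβ
  set ρ : ℝ × Model n → Model n := fun p => e (φ p.1 (e.symm p.2)) with hρ
  have hes : ∀ y ∈ e.target, ContMDiffAt 𝓘(ℝ, Model n) (𝓡 (2 * n + 1)) ∞ e.symm y := fun y hy =>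
    (contMDiffOn_extChartAt_symm x).contMDiffAt (hto.mem_nhds hy)
  have hexy : e.symm z = x := extChartAt_to_inv x
  have hφs : ∀ s, ContMDiff (𝓡 (2 * n + 1)) (𝓡 (2 * n + 1)) ∞ (φ s) := fun s =>
    hφ.comp (contMDiff_const.prodMk contMDiff_id)
  have hρs : ∀ s, ∀ y ∈ e.target, φ s (e.symm y) ∈ e.source → ContDiffAt ℝ ∞ ρ (s, y) := by
    intro s y hy hs
    rw [← contMDiffAt_iff_contDiffAt]
    have h1 : ContMDiffAt 𝓘(ℝ, ℝ × Model n) (𝓘(ℝ, ℝ).prod (𝓡 (2 * n + 1))) ∞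
        (fun p : ℝ × Model n => (p.1, e.symm p.2)) (s, y) :=
      (contDiff_fst.contMDiff.contMDiffAt).prodMk
        (ContMDiffAt.comp (s, y) (hes y hy) contDiff_snd.contMDiff.contMDiffAt)
    have h2 : ContMDiffAt 𝓘(ℝ, ℝ × Model n) (𝓡 (2 * n + 1)) ∞
        (fun p : ℝ × Model n => φ p.1 (e.symm p.2)) (s, y) :=
      ContMDiffAt.comp (s, y) (hφ.contMDiffAt (x := (s, e.symm y))) h1
    exact ContMDiffAt.comp (s, y)
      (contMDiffAt_extChartAt' (by rwa [extChartAt_source] at hs)) h2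
  have hmem0 : ∀ y ∈ e.target, φ 0 (e.symm y) ∈ e.source := fun y hy => by
    rw [hφ0]; exact e.map_target hy
  set w : Model n := mfderiv (𝓡 (2 * n + 1)) 𝓘(ℝ, Model n) e x v with hw
  have hev : mfderiv 𝓘(ℝ, Model n) (𝓡 (2 * n + 1)) e.symm z w = v := by
    have hcomp := mfderivWithin_extChartAt_symm_comp_mfderiv_extChartAt' (I := 𝓡 (2 * n + 1))
      (mem_extChartAt_source x)
    rw [ModelWithCorners.range_eq_univ, mfderivWithin_univ] at hcomp
    exact congrArg (fun A : Model n →L[ℝ] Model n => A v) hcomp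
  have hderiv : HasDerivAt (fun s => β (ρ (s, z)) (fderiv ℝ ρ (s, z) (0, w))) 0 0 := by
    refine hasDerivAt_pullback_flow (V := reebVector β)
      ((α.contDiffAt_chartForm (x₀ := x) hzt).differentiableAt (by simp))
      (hρs 0 z hzt (hmem0 z hzt)) ?_ ?_ ?_
      ((reebVector_spec (α.nondegenerateAt (x₀ := x) hzt)).2 w)
    · filter_upwards [hto.mem_nhds hzt] with y hy
      simp only [hρ, hφ0]
      exact e.right_inv hy
    · filter_upwards [hto.mem_nhds hzt] with y hy
      have hρy : HasFDerivAt ρ (fderiv ℝ ρ (0, y)) (0, y) :=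
        ((hρs 0 y hy (hmem0 y hy)).differentiableAt (by simp)).hasFDerivAt
      have hline : HasDerivAt (fun s : ℝ => (s, y)) ((1 : ℝ), (0 : Model n)) 0 :=
        (hasDerivAt_id (0 : ℝ)).prodMk (hasDerivAt_const (0 : ℝ) y)
      have h1 : HasDerivAt (fun s : ℝ => ρ (s, y)) (fderiv ℝ ρ (0, y) (1, 0)) 0 := by
        have h := hρy.comp_hasDerivAt (0 : ℝ) hline
        exact h
      have hme : HasMFDerivAt (𝓡 (2 * n + 1)) 𝓘(ℝ, Model n) e (φ 0 (e.symm y))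
          (mfderiv (𝓡 (2 * n + 1)) 𝓘(ℝ, Model n) e (φ 0 (e.symm y))) :=
        (mdifferentiableAt_extChartAt (by
          have := hmem0 y hy
          rwa [extChartAt_source] at this)).hasMFDerivAt
      let X : M → Model n := α.reebField
      let D : M → Model n →L[ℝ] Model n := fun p => mfderiv (𝓡 (2 * n + 1)) 𝓘(ℝ, Model n) e p
      have h2 : HasFDerivAt (fun s : ℝ => ρ (s, y)) ((D (φ 0 (e.symm y))).comp
          ((1 : ℝ →L[ℝ] ℝ).smulRight (X (φ 0 (e.symm y))))) 0 :=
        (hme.comp (0 : ℝ) (hφX (e.symm y) 0)).hasFDerivAt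
      rw [h1.unique h2.hasDerivAt]
      have hcomp := mfderiv_extChartAt_comp_mfderivWithin_extChartAt_symm (I := 𝓡 (2 * n + 1)) hy
      rw [ModelWithCorners.range_eq_univ, mfderivWithin_univ] at hcomp
      have hre := α.reebField_eq (x₀ := x) hy
      show D (φ 0 (e.symm y)) ((1 : ℝ) • X (φ 0 (e.symm y))) = _
      rw [hφ0, one_smul]
      have h4 := congrArg (fun A : Model n →L[ℝ] Model n => A (reebVector β y)) hcomp
      exact (congrArg (D (e.symm y)) hre).trans h4
    · filter_upwards [hto.mem_nhds hzt] with y hy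
      exact (reebVector_spec (α.nondegenerateAt (x₀ := x) hy)).1
  refine hderiv.congr_of_eventuallyEq ?_
  have hcont : ∀ᶠ s in nhds (0 : ℝ), φ s x ∈ e.source := by
    have hc : Continuous fun s => φ s x := hφ.continuous.comp (by fun_prop : Continuous fun s => (s, x))
    refine hc.continuousAt.eventually_mem ((isOpen_extChartAt_source x).mem_nhds ?_)
    rw [hφ0]
    exact mem_extChartAt_source x
  filter_upwards [hcont] with s hs
  have hs' : φ s (e.symm z) ∈ e.source := by rwa [hexy]
  have hρt : ρ (s, z) ∈ e.target := e.map_source hs'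
  have hback : e.symm (ρ (s, z)) = φ s x := by
    simp only [hρ, hexy]
    exact e.left_inv hs
  have h1 : HasMFDerivAt 𝓘(ℝ, Model n) 𝓘(ℝ, Model n) (fun y => ρ (s, y)) z
      ((fderiv ℝ ρ (s, z)).comp (.inr ℝ ℝ (Model n))) :=
    ((((hρs s z hzt hs').differentiableAt (by simp)).hasFDerivAt).comp z
      (hasFDerivAt_prodMk_right s z)).hasMFDerivAt
  have h2 := (mdifferentiableAt_extChartAt_symm (x₀ := x) (z := ρ (s, z)) hρt).hasMFDerivAt.comp z h1
  have h3 : HasMFDerivAt 𝓘(ℝ, Model n) (𝓡 (2 * n + 1)) (φ s ∘ e.symm) z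
      ((mfderiv (𝓡 (2 * n + 1)) (𝓡 (2 * n + 1)) (φ s) (e.symm z)).comp
        (mfderiv 𝓘(ℝ, Model n) (𝓡 (2 * n + 1)) e.symm z)) :=
    HasMFDerivAt.comp z (((hφs s).mdifferentiable (by simp)) (e.symm z)).hasMFDerivAt
      (mdifferentiableAt_extChartAt_symm hzt).hasMFDerivAt
  have hevq : φ s ∘ e.symm =ᶠ[nhds z] e.symm ∘ fun y => ρ (s, y) := by
    have h4 : ∀ᶠ y in nhds z, φ s (e.symm y) ∈ e.source :=
      (ContinuousAt.comp (g := φ s) (f := e.symm) (x := z) (hφs s).continuous.continuousAt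
        (hes z hzt).continuousAt).eventually_mem ((isOpen_extChartAt_source x).mem_nhds hs')
    filter_upwards [h4] with y hy
    exact (e.left_inv hy).symm
  have h5 := hasMFDerivAt_unique h3 (h2.congr_of_eventuallyEq hevq)
  let a : M → Model n →L[ℝ] ℝ := α.toFun
  let D : M → Model n →L[ℝ] Model n := fun p =>
    mfderiv (𝓡 (2 * n + 1)) (𝓡 (2 * n + 1)) (φ s) p
  have h6 : D (e.symm z) (mfderiv 𝓘(ℝ, Model n) (𝓡 (2 * n + 1)) e.symm z w) =
      mfderiv 𝓘(ℝ, Model n) (𝓡 (2 * n + 1)) e.symm (ρ (s, z)) (fderiv ℝ ρ (s, z) (0, w) : Model n) :=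
    congrArg (fun A : Model n →L[ℝ] Model n => A w) h5
  show a (φ s x) (D x v) = a (e.symm (ρ (s, z))) _
  rw [hback]
  refine congrArg (a (φ s x)) (Eq.trans ?_ h6)
  rw [hexy]
  exact congrArg (D x) hev.symm

/-- The Reeb flow preserves the contact form. -/
theorem ContactForm.pullback_reeb_flow (α : ContactForm n M) {φ : ℝ → M → M}
    (hφ : ContMDiff (𝓘(ℝ, ℝ).prod (𝓡 (2 * n + 1))) (𝓡 (2 * n + 1)) ∞
      (fun p : ℝ × M => φ p.1 p.2))
    (hφ0 : ∀ x, φ 0 x = x) (hφa : ∀ s t x, φ (s + t) x = φ s (φ t x))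
    (hφX : ∀ x, IsMIntegralCurve (fun t => φ t x) α.reebField)
    (t : ℝ) (x : M) (v : TangentSpace (𝓡 (2 * n + 1)) x) :
    α.toFun (φ t x) (mfderiv (𝓡 (2 * n + 1)) (𝓡 (2 * n + 1)) (φ t) x v) = α.toFun x v := by
  have hφs : ∀ s, ContMDiff (𝓡 (2 * n + 1)) (𝓡 (2 * n + 1)) ∞ (φ s) := fun s =>
    hφ.comp (contMDiff_const.prodMk contMDiff_id)
  set h : ℝ → ℝ := fun s =>
    α.toFun (φ s x) (mfderiv (𝓡 (2 * n + 1)) (𝓡 (2 * n + 1)) (φ s) x v) with hh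
  have hder : ∀ t, HasDerivAt h 0 t := by
    intro t
    have h1 := α.hasDerivAt_pullback_reeb_flow hφ hφ0 hφX (φ t x)
      (mfderiv (𝓡 (2 * n + 1)) (𝓡 (2 * n + 1)) (φ t) x v)
    -- The group law turns the derivative at time `t` into the one at time zero, taken at the point
    -- `φ t x` and the transported vector.
    have h2 : (fun s => α.toFun (φ s (φ t x)) (mfderiv (𝓡 (2 * n + 1)) (𝓡 (2 * n + 1)) (φ s) (φ t x)
        (mfderiv (𝓡 (2 * n + 1)) (𝓡 (2 * n + 1)) (φ t) x v))) = fun s => h (s + t) := by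
      funext s
      have hfun : φ (s + t) = φ s ∘ φ t := funext fun y => hφa s t y
      have hm := mfderiv_comp x ((hφs s).mdifferentiable (by simp) (φ t x))
        ((hφs t).mdifferentiable (by simp) x)
      simp only [hh]
      rw [hfun, hm]
      rfl
    rw [h2] at h1
    have h3 : HasDerivAt (fun s => h (s + t)) 0 (t - t) := by rwa [sub_self]
    simpa using h3.comp_sub_const t t
  have hconst : h t = h 0 :=
    is_const_of_deriv_eq_zero (fun s => (hder s).differentiableAt) (fun s => (hder s).deriv) t 0
  refine hconst.trans ?_
  have hid : φ 0 = id := funext hφ0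
  simp only [hh]
  rw [hid, mfderiv_id]
  rfl

end ContactGeometry

end

noncomputable section

/-! ### Smooth majorants and changes of time -/

section Analysis

/-- A continuous function on `[0, 1]` is bounded above by a smooth function of any prescribed
larger integral. -/
theorem exists_smooth_majorant {m : ℝ → ℝ} (hm : ContinuousOn m (Icc 0 1)) {c : ℝ}
    (hc : ∫ t in (0 : ℝ)..1, m t < c) :
    ∃ p : ℝ → ℝ, ContDiff ℝ ∞ p ∧ (∀ t ∈ Icc (0 : ℝ) 1, m t ≤ p t) ∧
      ∫ t in (0 : ℝ)..1, p t = c ∧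
      ((∀ t ∈ Icc (0 : ℝ) 1, 0 ≤ m t) → ∃ δ > 0, ∀ t, δ ≤ p t) := by
  set f : ℝ → ℝ := fun t => m (projIcc 0 1 zero_le_one t) with hf
  have hfm : ∀ t ∈ Icc (0 : ℝ) 1, f t = m t := fun t ht => by
    simp only [hf, projIcc_of_mem zero_le_one ht]
  have hfu : UniformContinuous f :=
    (CompactSpace.uniformContinuous_of_continuous (continuousOn_iff_continuous_domRestrict.1 hm)).comp
      (LipschitzWith.projIcc zero_le_one).uniformContinuous
  -- Half of the available gap. Since `g` is within `η / 2` of `f`, the shift `κ` that makes the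
  -- integral exactly `c` is at least `3 η / 2`, so `g + κ` exceeds `f` by at least `η` at every
  -- time.
  set η := (c - ∫ t in (0 : ℝ)..1, m t) / 2 with hη
  have hη0 : 0 < η := by simp only [hη]; linarith
  obtain ⟨g, hg, hgf⟩ := hfu.exists_contDiff_dist_le (half_pos hη0)
  have hgf' : ∀ t, |g t - f t| < η / 2 := fun t => by rw [← Real.dist_eq]; exact hgf t
  have hfi : ∫ t in (0 : ℝ)..1, f t = ∫ t in (0 : ℝ)..1, m t := by
    refine intervalIntegral.integral_congr fun t ht => ?_
    rw [uIcc_of_le zero_le_one] at ht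
    exact hfm t ht
  have hgi : ∫ t in (0 : ℝ)..1, g t ≤ (∫ t in (0 : ℝ)..1, m t) + η / 2 := by
    have h1 : ∫ t in (0 : ℝ)..1, g t ≤ ∫ t in (0 : ℝ)..1, (f t + η / 2) := by
      refine intervalIntegral.integral_mono_on zero_le_one (hg.continuous.intervalIntegrable _ _)
        ((hfu.continuous.add continuous_const).intervalIntegrable _ _) fun t _ => ?_
      have := (abs_lt.1 (hgf' t)).2
      linarith
    rw [intervalIntegral.integral_add (hfu.continuous.intervalIntegrable _ _)
      (continuous_const.intervalIntegrable _ _), hfi] at h1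
    simpa using h1
  set κ := c - ∫ t in (0 : ℝ)..1, g t with hκ
  have hκη : η + η / 2 ≤ κ := by
    simp only [hκ]
    have : c = (∫ t in (0 : ℝ)..1, m t) + 2 * η := by simp only [hη]; ring
    linarith
  have hpf : ∀ t, f t + η ≤ g t + κ := fun t => by
    have := (abs_lt.1 (hgf' t)).1
    linarith
  refine ⟨fun t => g t + κ, hg.add contDiff_const, fun t ht => ?_, ?_, fun hpos => ⟨η, hη0, fun t => ?_⟩⟩
  · have := hpf t
    rw [hfm t ht] at this
    linarith
  · rw [intervalIntegral.integral_add (hg.continuous.intervalIntegrable _ _)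
      (continuous_const.intervalIntegrable _ _)]
    simp [hκ]
  · have h1 := hpf t
    have h2 : 0 ≤ f t := hpos _ (projIcc 0 1 zero_le_one t).2
    linarith

theorem hasDerivAt_primitive {p : ℝ → ℝ} (hp : Continuous p) (t : ℝ) :
    HasDerivAt (fun u => ∫ r in (0 : ℝ)..u, p r) (p t) t :=
  (hp.integral_hasStrictDerivAt 0 t).hasDerivAt

theorem contDiff_primitive {p : ℝ → ℝ} (hp : ContDiff ℝ ∞ p) :
    ContDiff ℝ ∞ (fun u => ∫ r in (0 : ℝ)..u, p r) := by
  rw [contDiff_infty_iff_deriv]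
  have hd : deriv (fun u => ∫ r in (0 : ℝ)..u, p r) = p :=
    funext fun t => (hasDerivAt_primitive hp.continuous t).deriv
  exact ⟨fun t => (hasDerivAt_primitive hp.continuous t).differentiableAt, by rwa [hd]⟩

/-- A change of time of `[0, 1]` whose speed is inversely proportional to a positive function. -/
theorem exists_time_change {p : ℝ → ℝ} (hp : ContDiff ℝ ∞ p) {δ : ℝ} (hδ : 0 < δ)
    (hpδ : ∀ t, δ ≤ p t) {c : ℝ} (hc : ∫ t in (0 : ℝ)..1, p t = c) :
    ∃ τ : ℝ → ℝ, ContDiff ℝ ∞ τ ∧ τ 0 = 0 ∧ τ 1 = 1 ∧ MapsTo τ (Icc 0 1) (Icc 0 1) ∧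
      ∀ t, deriv τ t = c / p (τ t) := by
  have hc0 : 0 < c := by
    have h1 : ∫ _ in (0 : ℝ)..1, δ ≤ ∫ t in (0 : ℝ)..1, p t :=
      intervalIntegral.integral_mono_on zero_le_one (continuous_const.intervalIntegrable _ _)
        (hp.continuous.intervalIntegrable _ _) fun t _ => hpδ t
    simp only [intervalIntegral.integral_const, sub_zero, one_smul] at h1
    linarith
  -- The time change is the inverse of this normalised primitive: P' = p / c inverts to τ' = c /
  -- p(τ), and the normalisation gives P 1 = 1.
  set P : ℝ → ℝ := fun u => (∫ r in (0 : ℝ)..u, p r) / c with hP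
  have hPd : ∀ t, HasDerivAt P (p t / c) t := fun t =>
    (hasDerivAt_primitive hp.continuous t).div_const c
  have hPs : ContDiff ℝ ∞ P := (contDiff_primitive hp).div_const c
  have hppos : ∀ t, 0 < p t / c := fun t => div_pos (hδ.trans_le (hpδ t)) hc0
  have hPm : StrictMono P := strictMono_of_deriv_pos fun t => by
    rw [(hPd t).deriv]; exact hppos t
  have hP0 : P 0 = 0 := by simp [hP]
  have hP1 : P 1 = 1 := by simp [hP, hc, hc0.ne']
  -- The lower bound `δ` makes `P` grow at least linearly in both directions, hence surjective onto
  -- the line.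
  have hmono : Monotone fun u => P u - δ / c * u := by
    refine monotone_of_deriv_nonneg ?_ fun t => ?_
    · exact fun t => ((hPd t).sub ((hasDerivAt_id t).const_mul (δ / c))).differentiableAt
    · have h1 : HasDerivAt (fun u => P u - δ / c * u) (p t / c - δ / c * 1) t :=
        (hPd t).sub ((hasDerivAt_id t).const_mul (δ / c))
      rw [h1.deriv, mul_one, sub_nonneg]
      exact div_le_div_of_nonneg_right (hpδ t) hc0.le
  have hsurj : Function.Surjective P := by
    refine hPs.continuous.surjective ?_ ?_
    · refine Filter.tendsto_atTop_mono' _ ?_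
        (Filter.tendsto_id.const_mul_atTop (div_pos hδ hc0))
      filter_upwards [Filter.eventually_ge_atTop (0 : ℝ)] with u hu
      have := hmono hu
      simp only [hP0, mul_zero, sub_zero] at this
      simp only [id]
      linarith
    · refine Filter.tendsto_atBot_mono' _ ?_
        (Filter.tendsto_id.const_mul_atBot (div_pos hδ hc0))
      filter_upwards [Filter.eventually_le_atBot (0 : ℝ)] with u hu
      have := hmono hu
      simp only [hP0, mul_zero, sub_zero] at this
      simp only [id]
      linarith
  let e : ℝ ≃ₜ ℝ := (hPm.orderIsoOfSurjective P hsurj).toHomeomorph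
  have heP : ∀ t, e t = P t := fun _ => rfl
  have hes : ContDiff ℝ ∞ e.symm :=
    e.contDiff_symm_deriv (f' := fun t => p t / c) (fun t => (hppos t).ne') hPd hPs
  have he : ∀ t, P (e.symm t) = t := fun t => e.apply_symm_apply t
  have h0 : e.symm 0 = 0 := hPm.injective (by rw [he, hP0])
  have h1 : e.symm 1 = 1 := hPm.injective (by rw [he, hP1])
  have hesm : Monotone e.symm := (hPm.orderIsoOfSurjective P hsurj).symm.monotone
  refine ⟨e.symm, hes, h0, h1, fun t ht => ⟨?_, ?_⟩, fun t => ?_⟩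
  · rw [← h0]; exact hesm ht.1
  · rw [← h1]; exact hesm ht.2
  · have := HasDerivAt.of_local_left_inverse (f := P) (g := e.symm) (a := t)
      e.symm.continuous.continuousAt (hPd (e.symm t)) (hppos _).ne'
      (Filter.Eventually.of_forall he)
    rw [this.deriv, inv_div]

end Analysis

/-! ### Maxima of compactly supported functions -/

section Supremum

variable {M : Type*} [TopologicalSpace M] [Nonempty M] {H : ℝ → M → ℝ}

/-- All values outside the support are 0, so adding one outside point to the compact set captures
them. The supremum over `M` thus becomes a maximum over a compact set independent of `t`, which
gives boundedness and continuity in `t`. -/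
theorem exists_isCompact_forall_exists_eq
    (hK : ∃ K : Set M, IsCompact K ∧ ∀ t ∈ Icc (0 : ℝ) 1, ∀ x, x ∉ K → H t x = 0) :
    ∃ K : Set M, IsCompact K ∧ K.Nonempty ∧ ∀ t ∈ Icc (0 : ℝ) 1, ∀ x, ∃ y ∈ K, H t x = H t y := by
  obtain ⟨K, hKc, hK0⟩ := hK
  by_cases hKu : K = univ
  · subst hKu
    exact ⟨univ, hKc, univ_nonempty, fun t _ x => ⟨x, mem_univ x, rfl⟩⟩
  · obtain ⟨y, hy⟩ := (ne_univ_iff_exists_notMem K).1 hKu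
    refine ⟨insert y K, hKc.insert y, insert_nonempty _ _, fun t ht x => ?_⟩
    by_cases hx : x ∈ K
    · exact ⟨x, mem_insert_of_mem _ hx, rfl⟩
    · exact ⟨y, mem_insert _ _, by rw [hK0 t ht x hx, hK0 t ht y hy]⟩

theorem bddAbove_range_of_compactSupport
    (hc : ContinuousOn (fun p : ℝ × M => H p.1 p.2) (Icc 0 1 ×ˢ univ))
    (hK : ∃ K : Set M, IsCompact K ∧ ∀ t ∈ Icc (0 : ℝ) 1, ∀ x, x ∉ K → H t x = 0)
    {t : ℝ} (ht : t ∈ Icc (0 : ℝ) 1) : BddAbove (range (H t)) := by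
  obtain ⟨K, hKc, -, hKe⟩ := exists_isCompact_forall_exists_eq hK
  have hct : Continuous (H t) := by
    rw [← continuousOn_univ]
    exact hc.comp (by fun_prop : ContinuousOn (fun x : M => (t, x)) univ) fun x _ => ⟨ht, mem_univ x⟩
  refine (hKc.image hct).bddAbove.mono ?_
  rintro _ ⟨x, rfl⟩
  obtain ⟨y, hy, hxy⟩ := hKe t ht x
  exact ⟨y, hy, hxy.symm⟩

theorem continuousOn_iSup_of_compactSupport
    (hc : ContinuousOn (fun p : ℝ × M => H p.1 p.2) (Icc 0 1 ×ˢ univ))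
    (hK : ∃ K : Set M, IsCompact K ∧ ∀ t ∈ Icc (0 : ℝ) 1, ∀ x, x ∉ K → H t x = 0) :
    ContinuousOn (fun t => ⨆ x, H t x) (Icc 0 1) := by
  obtain ⟨K, hKc, -, hKe⟩ := exists_isCompact_forall_exists_eq hK
  rw [continuousOn_iff_continuous_domRestrict]
  have hcu : Continuous fun p : Icc (0 : ℝ) 1 × M => H p.1 p.2 :=
    hc.comp_continuous (f := fun p : Icc (0 : ℝ) 1 × M => ((p.1 : ℝ), p.2)) (by fun_prop)
      fun p => ⟨p.1.2, mem_univ _⟩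
  refine (hKc.continuous_sSup (f := fun (t : Icc (0 : ℝ) 1) x => H t x) hcu).congr fun t => ?_
  have : (fun x => H t x) '' K = range (H t) := by
    refine Subset.antisymm (image_subset_range _ _) ?_
    rintro _ ⟨x, rfl⟩
    obtain ⟨y, hy, hxy⟩ := hKe t t.2 x
    exact ⟨y, hy, hxy.symm⟩
  rw [this]
  rfl

end Supremum

end

noncomputable section

/-! ### Reparametrised and Reeb-twisted contact isotopies -/

namespace ContactGeometry

variable {n : ℕ} {M : Type*} [TopologicalSpace M] [ChartedSpace (Model n) M]
  {α : ContactForm n M}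

theorem ContactIsotopy.mdifferentiableWithinAt_curve (φ : ContactIsotopy α) {t : ℝ}
    (ht : t ∈ Icc (0 : ℝ) 1) (x : M) :
    MDifferentiableWithinAt 𝓘(ℝ, ℝ) (𝓡 (2 * n + 1)) (fun s => φ.toFun s x) (Icc 0 1) t := by
  have h : ContMDiffOn 𝓘(ℝ, ℝ) (𝓡 (2 * n + 1)) ∞ (fun s => φ.toFun s x) (Icc 0 1) :=
    φ.smooth.comp (contMDiff_id.prodMk contMDiff_const).contMDiffOn fun s hs => ⟨hs, mem_univ x⟩
  exact h.mdifferentiableOn (by simp) t ht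

theorem uniqueMDiffWithinAt_Icc_zero_one {t : ℝ} (ht : t ∈ Icc (0 : ℝ) 1) :
    UniqueMDiffWithinAt 𝓘(ℝ, ℝ) (Icc (0 : ℝ) 1) t :=
  uniqueMDiffWithinAt_iff_uniqueDiffWithinAt.2 (uniqueDiffOn_Icc zero_lt_one t ht)

theorem mfderivWithin_Icc_eq_deriv {a : ℝ → ℝ} {t : ℝ} (ha : DifferentiableAt ℝ a t)
    (ht : t ∈ Icc (0 : ℝ) 1) :
    (mfderivWithin 𝓘(ℝ, ℝ) 𝓘(ℝ, ℝ) a (Icc 0 1) t : ℝ →L[ℝ] ℝ) 1 = deriv a t := by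
  have h : mfderivWithin 𝓘(ℝ, ℝ) 𝓘(ℝ, ℝ) a (Icc 0 1) t = fderiv ℝ a t :=
    mfderivWithin_eq_fderivWithin.trans (ha.fderivWithin (uniqueDiffOn_Icc zero_lt_one t ht))
  exact (congrArg (fun A : ℝ →L[ℝ] ℝ => A 1) h).trans fderiv_apply_one_eq_deriv

/-- The reparametrisation `t ↦ φ_{τ(t)}` of a contact isotopy. -/
def ContactIsotopy.reparam (φ : ContactIsotopy α) (τ : ℝ → ℝ) (hτ : ContDiff ℝ ∞ τ) (h0 : τ 0 = 0)
    (hI : MapsTo τ (Icc 0 1) (Icc 0 1)) : ContactIsotopy α where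
  toFun t := φ.toFun (τ t)
  smooth := φ.smooth.comp ((hτ.contMDiff.comp contMDiff_fst).prodMk contMDiff_snd).contMDiffOn
    fun p hp => ⟨hI hp.1, mem_univ _⟩
  contact t ht := φ.contact (τ t) (hI ht)
  zero x := by rw [h0, φ.zero]
  compactSupport := by
    obtain ⟨K, hK, h⟩ := φ.compactSupport
    exact ⟨K, hK, fun t ht => h _ (hI ht)⟩

/-- The homotopy uses the time changes (1 - s) t + s τ(t), which stay in [0, 1] by convexity and fix
both end points. -/
theorem ContactIsotopy.homotopic_reparam (φ : ContactIsotopy α) {τ : ℝ → ℝ}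
    (hτ : ContDiff ℝ ∞ τ) (h0 : τ 0 = 0) (hI : MapsTo τ (Icc 0 1) (Icc 0 1)) (h1 : τ 1 = 1) :
    Homotopic φ (φ.reparam τ hτ h0 hI) := by
  -- `Homotopic` asks for a contact isotopy at every real `s`; clamping `s` keeps the interpolated
  -- time in [0, 1], and joint smoothness is only required where the clamp is the identity.
  set c : ℝ → ℝ := fun s => max 0 (min s 1) with hc
  have hc01 : ∀ s, c s ∈ Icc (0 : ℝ) 1 := fun s =>
    ⟨le_max_left _ _, max_le zero_le_one (min_le_right _ _)⟩
  have hcs : ∀ s ∈ Icc (0 : ℝ) 1, c s = s := fun s hs => by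
    simp only [hc, min_eq_left hs.2, max_eq_right hs.1]
  have hconv : ∀ s ∈ Icc (0 : ℝ) 1, ∀ t ∈ Icc (0 : ℝ) 1,
      (1 - s) * t + s * τ t ∈ Icc (0 : ℝ) 1 := fun s hs t ht =>
    convex_Icc (0 : ℝ) 1 ht (hI ht) (by linarith [hs.2]) hs.1 (by ring)
  refine ⟨fun s => φ.reparam (fun t => (1 - c s) * t + c s * τ t) (by fun_prop) (by simp [h0])
    (fun t ht => hconv _ (hc01 s) t ht), ?_, ?_, ?_, ?_, ?_⟩
  · have hθ : ContDiff ℝ ∞ (fun p : ℝ × ℝ => (1 - p.1) * p.2 + p.1 * τ p.2) := by fun_prop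
    have hθ' : ContMDiff (𝓘(ℝ, ℝ).prod (𝓘(ℝ, ℝ).prod (𝓡 (2 * n + 1)))) 𝓘(ℝ, ℝ) ∞
        (fun p : ℝ × ℝ × M => (1 - p.1) * p.2.1 + p.1 * τ p.2.1) :=
      hθ.contMDiff.comp (contMDiff_fst.prodMk_space (contMDiff_fst.comp contMDiff_snd))
    refine (φ.smooth.comp (hθ'.prodMk (contMDiff_snd.comp contMDiff_snd)).contMDiffOn
      fun p hp => ⟨hconv _ hp.1 _ hp.2.1, mem_univ _⟩).congr fun p hp => ?_
    simp only [reparam, hcs _ hp.1, Function.comp]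
  · obtain ⟨K, hK, h⟩ := φ.compactSupport
    exact ⟨K, hK, fun s _ t ht => h _ (hconv _ (hc01 s) t ht)⟩
  · intro t _ x
    simp [reparam, hcs 0 (by simp)]
  · intro t _ x
    simp [reparam, hcs 1 (by simp)]
  · intro s _ x
    simp [reparam, h1]

theorem Generates.reparam {H : ℝ → M → ℝ} {φ : ContactIsotopy α} (hφ : Generates H φ) {τ : ℝ → ℝ}
    (hτ : ContDiff ℝ ∞ τ) (h0 : τ 0 = 0) (hI : MapsTo τ (Icc 0 1) (Icc 0 1)) :
    Generates (fun t x => deriv τ t * H (τ t) x) (φ.reparam τ hτ h0 hI) where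
  isHamiltonian := by
    refine ⟨?_, ?_⟩
    · have h1 : ContMDiff (𝓘(ℝ, ℝ).prod (𝓡 (2 * n + 1))) 𝓘(ℝ, ℝ) ∞
          (fun p : ℝ × M => deriv τ p.1) :=
        (contDiff_infty_iff_deriv.1 hτ).2.contMDiff.comp contMDiff_fst
      exact h1.contMDiffOn.mul (hφ.isHamiltonian.smooth.comp
        ((hτ.contMDiff.comp contMDiff_fst).prodMk contMDiff_snd).contMDiffOn
        fun p hp => ⟨hI hp.1, mem_univ _⟩)
    · obtain ⟨K, hK, h⟩ := hφ.isHamiltonian.compactSupport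
      exact ⟨K, hK, fun t ht x hx => by rw [h _ (hI ht) x hx, mul_zero]⟩
  velocity_eq t ht x := by
    have hv : (φ.reparam τ hτ h0 hI).velocity t x = deriv τ t • φ.velocity (τ t) x := by
      have hd : DifferentiableAt ℝ τ t := hτ.differentiable (by simp) t
      have h1 := mfderivWithin_comp t (φ.mdifferentiableWithinAt_curve (hI ht) x)
        hd.mdifferentiableAt.mdifferentiableWithinAt hI (uniqueMDiffWithinAt_Icc_zero_one ht)
      have h2 := congrArg (fun A : ℝ →L[ℝ] Model n => A 1) h1
      refine h2.trans ?_
      refine (congrArg (mfderivWithin 𝓘(ℝ, ℝ) (𝓡 (2 * n + 1)) (fun s => φ.toFun s x) (Icc 0 1)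
        (τ t) : ℝ →L[ℝ] Model n) ((mfderivWithin_Icc_eq_deriv hd ht).trans
          (mul_one (deriv τ t)).symm)).trans ?_
      exact ContinuousLinearMap.map_smul (mfderivWithin 𝓘(ℝ, ℝ) (𝓡 (2 * n + 1))
        (fun s => φ.toFun s x) (Icc 0 1) (τ t) : ℝ →L[ℝ] Model n) (deriv τ t) 1
    rw [hv]
    exact (map_smul (α.toFun (φ.toFun (τ t) x)) _ _).trans
      (congrArg (deriv τ t * ·) (hφ.velocity_eq _ (hI ht) x))

variable (α) in
/-- A complete flow of the Reeb vector field of `α`. -/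
structure ReebFlow where
  /-- the flow at time `t` -/
  toFun : ℝ → M → M
  smooth : ContMDiff (𝓘(ℝ, ℝ).prod (𝓡 (2 * n + 1))) (𝓡 (2 * n + 1)) ∞
    (fun p : ℝ × M => toFun p.1 p.2)
  zero : ∀ x, toFun 0 x = x
  add : ∀ s t x, toFun (s + t) x = toFun s (toFun t x)
  isMIntegralCurve : ∀ x, IsMIntegralCurve (fun t => toFun t x) α.reebField

theorem nonempty_reebFlow [T2Space M] [CompactSpace M] [IsManifold (𝓡 (2 * n + 1)) ∞ M] :
    Nonempty (ReebFlow α) := by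
  obtain ⟨R, h1, h2, h3, h4⟩ := exists_flow_of_compactSpace (E := Model n) α.contMDiff_reebField
  exact ⟨⟨R, h1, h2, h3, h4⟩⟩

namespace ReebFlow

/-- The Reeb flow at time `t`, as a diffeomorphism. -/
def diffeo (R : ReebFlow α) (t : ℝ) : M ≃ₘ⟮𝓡 (2 * n + 1), 𝓡 (2 * n + 1)⟯ M where
  toFun := R.toFun t
  invFun := R.toFun (-t)
  left_inv x := by rw [← R.add, neg_add_cancel, R.zero]
  right_inv x := by rw [← R.add, add_neg_cancel, R.zero]
  contMDiff_toFun := R.smooth.comp (contMDiff_const.prodMk contMDiff_id)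
  contMDiff_invFun := R.smooth.comp (contMDiff_const.prodMk contMDiff_id)

@[simp]
theorem diffeo_apply (R : ReebFlow α) (t : ℝ) (x : M) : R.diffeo t x = R.toFun t x := rfl

theorem pullback [IsManifold (𝓡 (2 * n + 1)) ∞ M] (R : ReebFlow α) (t : ℝ) (x : M)
    (v : TangentSpace (𝓡 (2 * n + 1)) x) :
    α.toFun (R.toFun t x) (mfderiv (𝓡 (2 * n + 1)) (𝓡 (2 * n + 1)) (R.toFun t) x v) =
      α.toFun x v :=
  α.pullback_reeb_flow R.smooth R.zero R.add R.isMIntegralCurve t x v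

theorem preservesContact [IsManifold (𝓡 (2 * n + 1)) ∞ M] (R : ReebFlow α) (t : ℝ) :
    PreservesContact α (R.diffeo t) := fun x v => by
  have h := R.pullback t x v
  exact (Eq.congr_left h : _ = (0 : ℝ) ↔ _)

end ReebFlow

variable [IsManifold (𝓡 (2 * n + 1)) ∞ M] [CompactSpace M]

/-- The contact isotopy `t ↦ R_{a(t)} ∘ φ_t`, where `R` is the Reeb flow. -/
def ContactIsotopy.twist (φ : ContactIsotopy α) (R : ReebFlow α) (a : ℝ → ℝ)
    (ha : ContDiff ℝ ∞ a) (h0 : a 0 = 0) : ContactIsotopy α where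
  toFun t := (φ.toFun t).trans (R.diffeo (a t))
  smooth := R.smooth.comp_contMDiffOn ((ha.contMDiff.comp contMDiff_fst).contMDiffOn.prodMk φ.smooth)
  contact t ht := (R.preservesContact (a t)).comp (φ.contact t ht)
  zero x := by simp [h0, φ.zero, R.zero]
  compactSupport := ⟨univ, isCompact_univ, fun _ _ x hx => (hx (mem_univ x)).elim⟩

/-- Scaling `a` by `s` joins the trivial twist to the given one; the end point is fixed because `a 1
= 0`. Compactness of `M` makes the support condition void. -/
theorem ContactIsotopy.homotopic_twist (φ : ContactIsotopy α) (R : ReebFlow α) {a : ℝ → ℝ}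
    (ha : ContDiff ℝ ∞ a) (h0 : a 0 = 0) (h1 : a 1 = 0) : Homotopic φ (φ.twist R a ha h0) := by
  refine ⟨fun s => φ.twist R (fun t => s * a t) (by fun_prop) (by simp [h0]), ?_,
    ⟨univ, isCompact_univ, fun _ _ _ _ x hx => (hx (mem_univ x)).elim⟩, ?_, ?_, ?_⟩
  · have hθ : ContDiff ℝ ∞ (fun p : ℝ × ℝ => p.1 * a p.2) := by fun_prop
    have hθ' : ContMDiff (𝓘(ℝ, ℝ).prod (𝓘(ℝ, ℝ).prod (𝓡 (2 * n + 1)))) 𝓘(ℝ, ℝ) ∞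
        (fun p : ℝ × ℝ × M => p.1 * a p.2.1) :=
      hθ.contMDiff.comp (contMDiff_fst.prodMk_space (contMDiff_fst.comp contMDiff_snd))
    exact R.smooth.comp_contMDiffOn (hθ'.contMDiffOn.prodMk
      (φ.smooth.comp contMDiff_snd.contMDiffOn fun p hp => hp.2))
  · intro t _ x
    simp [twist, R.zero]
  · intro t _ x
    simp [twist]
  · intro s _ x
    simp [twist, h1, R.zero]

/-- The velocity of R_a ∘ φ is a' times the Reeb vector plus the image under dR_a of the velocity of
φ. The form α takes the value 1 on the Reeb vector and is preserved by R_a, so the two terms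
contribute a' and H at the point moved back by R_{-a}. -/
theorem Generates.twist {H : ℝ → M → ℝ} {φ : ContactIsotopy α} (hφ : Generates H φ)
    (R : ReebFlow α) {a : ℝ → ℝ} (ha : ContDiff ℝ ∞ a) (h0 : a 0 = 0) :
    Generates (fun t y => deriv a t + H t (R.toFun (-a t) y)) (φ.twist R a ha h0) where
  isHamiltonian := by
    refine ⟨?_, univ, isCompact_univ, fun _ _ x hx => (hx (mem_univ x)).elim⟩
    have h1 : ContMDiff (𝓘(ℝ, ℝ).prod (𝓡 (2 * n + 1))) 𝓘(ℝ, ℝ) ∞ (fun p : ℝ × M => deriv a p.1) :=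
      (contDiff_infty_iff_deriv.1 ha).2.contMDiff.comp contMDiff_fst
    have h2 : ContMDiff (𝓘(ℝ, ℝ).prod (𝓡 (2 * n + 1))) (𝓡 (2 * n + 1)) ∞
        (fun p : ℝ × M => R.toFun (-a p.1) p.2) :=
      R.smooth.comp ((ha.neg.contMDiff.comp contMDiff_fst).prodMk contMDiff_snd)
    exact h1.contMDiffOn.add (hφ.isHamiltonian.smooth.comp
      (contMDiff_fst.prodMk h2).contMDiffOn fun p hp => ⟨hp.1, mem_univ _⟩)
  velocity_eq t ht x := by
    set F : ℝ × M → M := fun p => R.toFun p.1 p.2 with hF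
    have hFd : MDifferentiableAt (𝓘(ℝ, ℝ).prod (𝓡 (2 * n + 1))) (𝓡 (2 * n + 1)) F
        (a t, φ.toFun t x) := R.smooth.mdifferentiableAt (by simp)
    have had : DifferentiableAt ℝ a t := ha.differentiable (by simp) t
    have hg := had.mdifferentiableAt.mdifferentiableWithinAt (s := Icc 0 1)
    have hc := φ.mdifferentiableWithinAt_curve ht x
    have hu := uniqueMDiffWithinAt_Icc_zero_one ht
    have h1 := (hFd.hasMFDerivAt.comp_hasMFDerivWithinAt t
      (hg.hasMFDerivWithinAt.prodMk hc.hasMFDerivWithinAt)).mfderivWithin hu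
    have h2 := congrArg (fun A : ℝ →L[ℝ] Model n => A 1) h1
    have h3 := mfderiv_prod_eq_add_apply (v := ((deriv a t, φ.velocity t x) : ℝ × Model n)) hFd
    have hR : (mfderiv 𝓘(ℝ, ℝ) (𝓡 (2 * n + 1)) (fun z => F (z, φ.toFun t x)) (a t) :
        ℝ →L[ℝ] Model n) (deriv a t) = deriv a t • α.reebField (F (a t, φ.toFun t x)) := by
      rw [(R.isMIntegralCurve (φ.toFun t x) (a t)).mfderiv]
      rfl
    -- Chain rule for the flow map in its two variables, time and space.
    have hv : (φ.twist R a ha h0).velocity t x =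
        deriv a t • α.reebField (F (a t, φ.toFun t x)) +
          mfderiv (𝓡 (2 * n + 1)) (𝓡 (2 * n + 1)) (R.toFun (a t)) (φ.toFun t x)
            (φ.velocity t x) := by
      refine h2.trans (Eq.trans ?_ (h3.trans (congrArg (· + (_ : Model n)) hR)))
      have hp : ((mfderivWithin 𝓘(ℝ, ℝ) 𝓘(ℝ, ℝ) a (Icc 0 1) t : ℝ →L[ℝ] ℝ) 1, φ.velocity t x) =
          ((deriv a t, φ.velocity t x) : ℝ × Model n) :=
        congrArg (fun r : ℝ => ((r, φ.velocity t x) : ℝ × Model n))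
          (mfderivWithin_Icc_eq_deriv had ht)
      exact congrArg (mfderiv (𝓘(ℝ, ℝ).prod (𝓡 (2 * n + 1))) (𝓡 (2 * n + 1)) F
        (a t, φ.toFun t x) : ℝ × Model n →L[ℝ] Model n) hp
    have hinv : R.toFun (-a t) ((φ.twist R a ha h0).toFun t x) = φ.toFun t x :=
      (R.diffeo (a t)).left_inv (φ.toFun t x)
    rw [hv, hinv]
    refine (map_add (α.toFun (F (a t, φ.toFun t x))) _ _).trans ?_
    refine congrArg₂ (· + ·) ?_ ((R.pullback (a t) _ _).trans (hφ.velocity_eq t ht x))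
    refine (map_smul (α.toFun (F (a t, φ.toFun t x))) _ _).trans ?_
    rw [α.apply_reebField, smul_eq_mul, mul_one]

end ContactGeometry

end

noncomputable section

/-! ### From integral bounds to uniform bounds -/

namespace ContactGeometry

variable {n : ℕ} {M : Type*} [TopologicalSpace M] [ChartedSpace (Model n) M]
  {α : ContactForm n M} {H : ℝ → M → ℝ}

theorem IsHamiltonian.comp_real (hH : IsHamiltonian n H) {g : ℝ → ℝ} (hg : Continuous g)
    (h0 : g 0 = 0) : ContinuousOn (fun p : ℝ × M => g (H p.1 p.2)) (Icc 0 1 ×ˢ univ) ∧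
      ∃ K : Set M, IsCompact K ∧ ∀ t ∈ Icc (0 : ℝ) 1, ∀ x, x ∉ K → g (H t x) = 0 := by
  obtain ⟨K, hK, h⟩ := hH.compactSupport
  exact ⟨hg.comp_continuousOn hH.smooth.continuousOn, K, hK,
    fun t ht x hx => by rw [h t ht x hx, h0]⟩

section Nonempty

variable [Nonempty M]

theorem IsHamiltonian.bddAbove_range (hH : IsHamiltonian n H) {g : ℝ → ℝ} (hg : Continuous g)
    (h0 : g 0 = 0) {t : ℝ} (ht : t ∈ Icc (0 : ℝ) 1) : BddAbove (range fun x => g (H t x)) :=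
  bddAbove_range_of_compactSupport (H := fun t x => g (H t x)) (hH.comp_real hg h0).1
    (hH.comp_real hg h0).2 ht

theorem IsHamiltonian.continuousOn_iSup (hH : IsHamiltonian n H) {g : ℝ → ℝ} (hg : Continuous g)
    (h0 : g 0 = 0) : ContinuousOn (fun t => ⨆ x, g (H t x)) (Icc 0 1) :=
  continuousOn_iSup_of_compactSupport (H := fun t x => g (H t x)) (hH.comp_real hg h0).1
    (hH.comp_real hg h0).2

theorem IsHamiltonian.integral_iSup_mono (hH : IsHamiltonian n H) {f g : ℝ → ℝ}
    (hf : Continuous f) (hf0 : f 0 = 0) (hg : Continuous g) (hg0 : g 0 = 0) (hfg : ∀ r, f r ≤ g r) :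
    ∫ t in (0 : ℝ)..1, ⨆ x, f (H t x) ≤ ∫ t in (0 : ℝ)..1, ⨆ x, g (H t x) := by
  have hu : uIcc (0 : ℝ) 1 = Icc 0 1 := uIcc_of_le zero_le_one
  refine intervalIntegral.integral_mono_on zero_le_one
    (ContinuousOn.intervalIntegrable (by rw [hu]; exact hH.continuousOn_iSup hf hf0))
    (ContinuousOn.intervalIntegrable (by rw [hu]; exact hH.continuousOn_iSup hg hg0)) fun t ht => ?_
  exact ciSup_mono (hH.bddAbove_range hg hg0 ht) fun x => hfg _

theorem IsHamiltonian.integral_iSup_le (hH : IsHamiltonian n H) {g : ℝ → ℝ}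
    (hg : Continuous g) (hg0 : g 0 = 0) {c : ℝ} (hc : ∀ t ∈ Icc (0 : ℝ) 1, ∀ x, g (H t x) ≤ c) :
    ∫ t in (0 : ℝ)..1, ⨆ x, g (H t x) ≤ c := by
  have hu : uIcc (0 : ℝ) 1 = Icc 0 1 := uIcc_of_le zero_le_one
  have h := intervalIntegral.integral_mono_on zero_le_one
    (ContinuousOn.intervalIntegrable (by rw [hu]; exact hH.continuousOn_iSup hg hg0))
    (intervalIntegrable_const (μ := MeasureTheory.volume) (c := c)) fun t ht => ciSup_le (hc t ht)
  simpa using h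

end Nonempty

/-- An isotopy may be replaced by a homotopic one without changing which elements it connects. -/
theorem toCover_mul_eq {φ ψ : ContactIsotopy α} {f₀ f₁ : UniversalCover α}
    (h : Homotopic φ ψ) (hφ : φ.toCover * f₀ = f₁) : ψ.toCover * f₀ = f₁ := by
  rw [← hφ]
  exact congrArg (· * f₀) (Quot.sound h).symm

theorem max_deltaSH_le_dSH [Nonempty M] (f₀ f₁ : UniversalCover α) :
    max (max (deltaMinusSH f₀ f₁) (deltaPlusSH f₀ f₁)) 0 ≤ dSH f₀ f₁ := by
  refine le_sInf ?_
  rintro _ ⟨H, hH, rfl⟩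
  obtain ⟨φ, hφ, -⟩ := id hH
  have hHam := hφ.isHamiltonian
  refine max_le (max_le ?_ ?_) (EReal.coe_nonneg.2 ?_)
  · exact sInf_le_of_le ⟨H, hH, rfl⟩ (EReal.coe_le_coe_iff.2
      (hHam.integral_iSup_mono continuous_neg neg_zero continuous_abs abs_zero neg_le_abs))
  · exact sInf_le_of_le ⟨H, hH, rfl⟩ (EReal.coe_le_coe_iff.2
      (hHam.integral_iSup_mono continuous_id rfl continuous_abs abs_zero le_abs_self))
  · exact intervalIntegral.integral_nonneg zero_le_one fun t _ =>
      Real.iSup_nonneg fun x => abs_nonneg _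

/-- On an open contact manifold, a change of time turns an integral bound for the maximum of a
Hamiltonian into a uniform bound. -/
theorem Connects.exists_le_of_not_compactSpace [Nonempty M] (hM : ¬ CompactSpace M)
    {f₀ f₁ : UniversalCover α} (hH : Connects H f₀ f₁) {s : ℝ} {c : ℝ}
    (hc : ∫ t in (0 : ℝ)..1, ⨆ x, s * H t x < c) :
    ∃ K : ℝ → M → ℝ, Connects K f₀ f₁ ∧ ∀ t ∈ Icc (0 : ℝ) 1, ∀ x, s * K t x ≤ c := by
  obtain ⟨φ, hφ, hφf⟩ := hH
  have hsc : Continuous fun r : ℝ => s * r := continuous_const_mul s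
  have hbdd := fun t (ht : t ∈ Icc (0 : ℝ) 1) =>
    hφ.isHamiltonian.bddAbove_range hsc (mul_zero s) ht
  -- Non-compactness enters here: the Hamiltonian vanishes at some point outside its support, so the
  -- maximum is non-negative and the majorant can be made positive.
  have h0 : ∀ t ∈ Icc (0 : ℝ) 1, 0 ≤ ⨆ x, s * H t x := by
    obtain ⟨K, hK, hK0⟩ := hφ.isHamiltonian.compactSupport
    have hKu : K ≠ univ := fun h => hM ⟨h ▸ hK⟩
    obtain ⟨y, hy⟩ := (ne_univ_iff_exists_notMem K).1 hKu
    intro t ht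
    have h := le_ciSup (hbdd t ht) y
    simpa [hK0 t ht y hy] using h
  obtain ⟨p, hp, hmp, hpc, hδ⟩ := exists_smooth_majorant
    (hφ.isHamiltonian.continuousOn_iSup hsc (mul_zero s)) hc
  obtain ⟨δ, hδ, hδp⟩ := hδ h0
  obtain ⟨τ, hτ, hτ0, hτ1, hI, hτ'⟩ := exists_time_change hp hδ hδp hpc
  refine ⟨_, ⟨_, hφ.reparam hτ hτ0 hI, toCover_mul_eq (φ.homotopic_reparam hτ hτ0 hI hτ1) hφf⟩,
    fun t ht x => ?_⟩
  have hp0 : 0 < p (τ t) := hδ.trans_le (hδp _)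
  have hc0 : 0 ≤ c := by
    rw [← hpc]
    exact intervalIntegral.integral_nonneg zero_le_one fun t _ => hδ.le.trans (hδp t)
  have h1 : s * H (τ t) x ≤ p (τ t) := (le_ciSup (hbdd _ (hI ht)) x).trans (hmp _ (hI ht))
  calc s * (deriv τ t * H (τ t) x) = c / p (τ t) * (s * H (τ t) x) := by rw [hτ']; ring
    _ ≤ c / p (τ t) * p (τ t) := by gcongr
    _ = c := div_mul_cancel₀ c hp0.ne'

variable [IsManifold (𝓡 (2 * n + 1)) ∞ M]

/-- On a closed contact manifold, composing with the Reeb flow turns an integral bound for the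
maximum of a Hamiltonian into a uniform bound. -/
theorem Connects.exists_le_of_compactSpace [T2Space M] [Nonempty M] [CompactSpace M]
    {f₀ f₁ : UniversalCover α} (hH : Connects H f₀ f₁) {s : ℝ} (hs : s * s = 1) {c : ℝ}
    (hc : ∫ t in (0 : ℝ)..1, ⨆ x, s * H t x < c) :
    ∃ K : ℝ → M → ℝ, Connects K f₀ f₁ ∧ ∀ t ∈ Icc (0 : ℝ) 1, ∀ x, s * K t x ≤ c := by
  obtain ⟨φ, hφ, hφf⟩ := hH
  have hsc : Continuous fun r : ℝ => s * r := continuous_const_mul s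
  obtain ⟨R⟩ := nonempty_reebFlow (α := α)
  obtain ⟨p, hp, hmp, hpc, -⟩ := exists_smooth_majorant
    (hφ.isHamiltonian.continuousOn_iSup hsc (mul_zero s)) hc
  -- Chosen so that `s` times the derivative is c - p, using s² = 1; it vanishes at 0, and at 1
  -- because p has integral `c`.
  have ha : ContDiff ℝ ∞ fun t => s * (c * t - ∫ u in (0 : ℝ)..t, p u) :=
    contDiff_const.mul ((contDiff_const.mul contDiff_id).sub (contDiff_primitive hp))
  have ha' : ∀ t, deriv (fun t => s * (c * t - ∫ u in (0 : ℝ)..t, p u)) t = s * (c - p t) :=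
    fun t => by
      have h := (((hasDerivAt_id t).const_mul c).sub
        (hasDerivAt_primitive hp.continuous t)).const_mul s
      simpa using h.deriv
  refine ⟨_, ⟨_, hφ.twist R ha (by simp), toCover_mul_eq (φ.homotopic_twist R ha (by simp)
    (by simp [hpc])) hφf⟩, fun t ht x => ?_⟩
  have h1 : ∀ y, s * H t y ≤ p t := fun y =>
    (le_ciSup (hφ.isHamiltonian.bddAbove_range hsc (mul_zero s) ht) y).trans (hmp t ht)
  rw [ha', mul_add, ← mul_assoc, hs]
  linarith [h1 (R.toFun (-(s * (c * t - ∫ u in (0 : ℝ)..t, p u))) x)]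

theorem Connects.exists_le [T2Space M] [Nonempty M] {f₀ f₁ : UniversalCover α}
    (hH : Connects H f₀ f₁) {s : ℝ} (hs : s * s = 1) {c : ℝ}
    (hc : ∫ t in (0 : ℝ)..1, ⨆ x, s * H t x < c) :
    ∃ K : ℝ → M → ℝ, Connects K f₀ f₁ ∧ ∀ t ∈ Icc (0 : ℝ) 1, ∀ x, s * K t x ≤ c := by
  by_cases hM : CompactSpace M
  · exact hH.exists_le_of_compactSpace hs hc
  · exact hH.exists_le_of_not_compactSpace hM hc

/-- The infimum of the integrals of the maxima of `± H` agrees with the infimum of the uniform upper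
bounds of `± H`. -/
theorem sInf_integral_iSup_eq_sInf_bound [T2Space M] [Nonempty M] (f₀ f₁ : UniversalCover α)
    {s : ℝ} (hs : s * s = 1) :
    sInf {e : EReal | ∃ H : ℝ → M → ℝ, Connects H f₀ f₁ ∧
        e = ((∫ t in (0 : ℝ)..1, ⨆ x, s * H t x : ℝ) : EReal)} =
      sInf {e : EReal | ∃ ε : ℝ, e = ε ∧ ∃ H : ℝ → M → ℝ, Connects H f₀ f₁ ∧
        ∀ t ∈ Icc (0 : ℝ) 1, ∀ x, s * H t x ≤ ε} := by
  apply le_antisymm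
  · refine le_sInf ?_
    rintro _ ⟨ε, rfl, H, hH, hε⟩
    obtain ⟨φ, hφ, -⟩ := id hH
    exact sInf_le_of_le ⟨H, hH, rfl⟩ (EReal.coe_le_coe_iff.2
      (hφ.isHamiltonian.integral_iSup_le (continuous_const_mul s) (mul_zero s) hε))
  · refine le_sInf ?_
    rintro _ ⟨H, hH, rfl⟩
    -- The uniform bound is reached only for constants strictly above the integral, which is enough
    -- for the infimum.
    rw [← EReal.le_of_forall_lt_iff_le]
    intro c hc
    obtain ⟨K, hK, hKc⟩ := hH.exists_le hs (EReal.coe_lt_coe_iff.1 hc)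
    exact sInf_le ⟨c, rfl, K, hK, hKc⟩

theorem deltaPlusSH_eq_deltaPlus [T2Space M] [Nonempty M] (f₀ f₁ : UniversalCover α) :
    deltaPlusSH f₀ f₁ = deltaPlus f₀ f₁ := by
  have h := sInf_integral_iSup_eq_sInf_bound f₀ f₁ (s := 1) (by norm_num)
  simp only [one_mul] at h
  exact h

theorem deltaMinusSH_eq_deltaMinus [T2Space M] [Nonempty M] (f₀ f₁ : UniversalCover α) :
    deltaMinusSH f₀ f₁ = deltaMinus f₀ f₁ := by
  have h := sInf_integral_iSup_eq_sInf_bound f₀ f₁ (s := -1) (by norm_num)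
  -- Rewrites the bound -H ≤ ε as -ε ≤ H, the form used in `deltaMinus`.
  simp only [neg_mul, one_mul, neg_le (b := (_ : ℝ))] at h
  exact h

end ContactGeometry

end

open ContactGeometry in
theorem mainTheorem7 (n : ℕ) (M : Type*) [TopologicalSpace M] [T2Space M]
    [SecondCountableTopology M] [ConnectedSpace M]
    [ChartedSpace (EuclideanSpace ℝ (Fin (2 * n + 1))) M]
    [IsManifold (𝓡 (2 * n + 1)) ∞ M]
    (α : ContactForm n M) (f₀ f₁ : UniversalCover α) :
    deltaPlusSH f₀ f₁ = deltaPlus f₀ f₁ ∧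
    deltaMinusSH f₀ f₁ = deltaMinus f₀ f₁ ∧
    dTilde f₀ f₁ = max (max (deltaMinusSH f₀ f₁) (deltaPlusSH f₀ f₁)) 0 ∧
    dTilde f₀ f₁ ≤ dSH f₀ f₁ := by
  have h : dTilde f₀ f₁ = max (max (deltaMinusSH f₀ f₁) (deltaPlusSH f₀ f₁)) 0 := by
    rw [deltaPlusSH_eq_deltaPlus, deltaMinusSH_eq_deltaMinus]
    rfl
  exact ⟨deltaPlusSH_eq_deltaPlus f₀ f₁, deltaMinusSH_eq_deltaMinus f₀ f₁, h,
    h ▸ max_deltaSH_le_dSH f₀ f₁⟩
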